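/- **Theorem 4.1.** Let $S_{1,1}$ be a one-holed torus and let $a,b$ be simple closed curves on $S_{1,1}$ which intersect exactly once, transversely; the commutator $aba^{-1}b^{-1}$ represents the simple closed curve surrounding the hole. For $L_\partial\ge 0$ let $\mathrm{Teich}_{1,1}(L_\partial)$ be the relative Teichmüller space, that is, the space of all marked complete hyperbolic structures on $S_{1,1}$ whose neck geodesic has length $L_\partial$ (where $L_\partial=0$ means that the hole is a cusp), up to isometries that respect the marking. For a closed curve $c$, let $L_c$ denote the geodesic length of $c$, as a function on $\mathrm{Teich}_{1,1}(L_\partial)$. The coordinates $(L_a,L_b,L_{ab})$ take values in $$\mathrm{Teich}^{\mathrm{length}}_{1,1}(L_\partial)=\Big\{(L_a,L_b,L_{ab})\in(\mathbb R_{>0})^3 \;:\; x^2+y^2+z^2-xyz=2-2\cosh\tfrac{L_\partial}{2}\Big\},$$ where $x=2\cosh\frac{L_a}{2}$, $y=2\cosh\frac{L_b}{2}$, $z=2\cosh\frac{L_{ab}}{2}$. Let $n\ge 3$ be an integer. Then the equation $$\frac n2\,\tanh\frac{nL_b^*}{4}\,\tanh\frac{L_b^*}{2}=1$$ has a unique positive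 solution $L_b^*$. For every $L_\partial\ge 0$, the geodesic length function $L_{a^2b^n}$ attains its minimum over $\mathrm{Teich}_{1,1}(L_\partial)$ at exactly one point. The length coordinates of this point are a triple $(L_a^*,L_b^*,L_{ab}^*)\in \mathrm{Teich}^{\mathrm{length}}_{1,1}(L_\partial)$ whose second entry is the above solution $L_b^*$ (so it does not depend on $L_\partial$), and the minimum value $L^{\min}_{a^2b^n}$ satisfies $$\sinh\frac{L^{\min}_{a^2b^n}}{4}=\frac n2\cosh\frac{L_\partial}{4}\,\sinh\frac{nL_b^*}{4}\Big/\cosh\frac{L_b^*}{2}.$$ -/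

import Mathlib

open scoped UpperHalfPlane MatrixGroups

namespace OneHoledTorus

noncomputable section

/-- The fundamental group of the one-holed torus, based at the intersection point of the two
simple closed curves `a` and `b`: the free group on their classes. -/
abbrev Pi1 : Type := FreeGroup (Fin 2)

/-- The class of the simple closed curve `a`. -/
def a : Pi1 := FreeGroup.of 0

/-- The class of the simple closed curve `b`. -/
def b : Pi1 := FreeGroup.of 1

/-- The translation length of an isometry of the hyperbolic plane (the upper half-plane with the
Poincaré metric). For a deck transformation of a hyperbolic surface this is the infimum of the
lengths of the closed curves in the corresponding free homotopy class, that is, the length of the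
closed geodesic in that class, and `0` if the class surrounds a cusp. -/
def translationLength (f : ℍ ≃ᵢ ℍ) : ℝ := ⨅ z : ℍ, dist z (f z)

/-- The set of points that an isometry moves by exactly its translation length. For a hyperbolic
isometry it is the axis, and for a parabolic isometry it is empty. -/
def axis (f : ℍ ≃ᵢ ℍ) : Set ℍ := {z | dist z (f z) = translationLength f}

/-- A marked complete hyperbolic structure on the one-holed torus with neck geodesic of
length `L` (a cusp if `L = 0`), given by its holonomy: the surface is the quotient of the hyperbolic
plane by the group of deck transformations `hol g`, and `hol` is the identification of the
fundamental group with that group. -/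
structure MarkedStructure (L : ℝ) where
  /-- The holonomy representation. -/
  hol : Pi1 →* (ℍ ≃ᵢ ℍ)
  /-- The holonomy consists of orientation-preserving isometries, that is, of real Möbius
  transformations. -/
  orientation_preserving : ∀ g, ∃ M : SL(2, ℝ), ∀ z : ℍ, hol g z = M • z
  /-- The action on the hyperbolic plane is free (in particular, `hol` is injective). -/
  free : ∀ (g : Pi1) (z : ℍ), hol g z = z → g = 1
  /-- The action on the hyperbolic plane is properly discontinuous. -/
  properly_discontinuous :
    ∀ K : Set ℍ, IsCompact K → {g : Pi1 | ((hol g '' K) ∩ K).Nonempty}.Finite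
  /-- The closed geodesic `a` is simple: distinct lifts of it are disjoint. -/
  simple_a : ∀ g, hol g '' axis (hol a) = axis (hol a) ∨
    Disjoint (hol g '' axis (hol a)) (axis (hol a))
  /-- The closed geodesic `b` is simple. -/
  simple_b : ∀ g, hol g '' axis (hol b) = axis (hol b) ∨
    Disjoint (hol g '' axis (hol b)) (axis (hol b))
  /-- The closed geodesics `a` and `b` meet exactly once on the surface: their lifts through the
  base point meet at some `z₀`, and every intersection of lifts of them projects to the same point
  of the surface as `z₀` does. (They cannot overlap in an arc, so the intersection is
  transverse.) -/
  meet_once : ∃ z₀ ∈ axis (hol a) ∩ axis (hol b),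
    ∀ g, ∀ w ∈ axis (hol a) ∩ hol g '' axis (hol b), ∃ h, w = hol h z₀
  /-- The simple closed curve `a b a⁻¹ b⁻¹` surrounding the hole has length `L`. -/
  neck : translationLength (hol (a * b * a⁻¹ * b⁻¹)) = L

/-- Two marked structures are equivalent if there is an isometry between the surfaces that respects
the markings, that is, if their holonomies are conjugate by an isometry of the hyperbolic plane.
The structures are not oriented, so the isometry may reverse the orientation; a class contains
exactly one conjugacy class in `PSL(2, ℝ)` for either orientation of the one-holed torus. -/
instance markedSetoid (L : ℝ) : Setoid (MarkedStructure L) where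
  r X Y := ∃ f : ℍ ≃ᵢ ℍ, ∀ g, Y.hol g = f * X.hol g * f⁻¹
  iseqv :=
    { refl := fun X => ⟨1, fun g => by simp⟩
      symm := by
        rintro X Y ⟨f, hf⟩
        exact ⟨f⁻¹, fun g => by rw [hf]; group⟩
      trans := by
        rintro X Y Z ⟨f, hf⟩ ⟨f', hf'⟩
        exact ⟨f' * f, fun g => by rw [hf', hf]; group⟩ }

/-- The relative Teichmüller space of the one-holed torus with neck geodesic of length `L`. -/
def Teich (L : ℝ) : Type := Quotient (markedSetoid L)

theorem translationLength_conj (f h : ℍ ≃ᵢ ℍ) :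
    translationLength (f * h * f⁻¹) = translationLength h := by
  unfold translationLength
  refine (Equiv.iInf_congr f.toEquiv fun z => ?_).symm
  change dist (f z) (f (h (f.symm (f z)))) = dist z (h z)
  rw [f.symm_apply_apply, f.dist_eq]

/-- The geodesic length function on the relative Teichmüller space of the closed curve in the
class `g`. -/
def Teich.length {L : ℝ} (X : Teich L) (g : Pi1) : ℝ :=
  Quotient.lift (fun S : MarkedStructure L => translationLength (S.hol g))
    (by
      rintro S T ⟨f, hf⟩
      rw [hf, translationLength_conj]) X

/-- The relative Teichmüller space in the length coordinates `(L_a, L_b, L_ab)`. -/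
def TeichLength (L : ℝ) : Set (ℝ × ℝ × ℝ) :=
  {p | 0 < p.1 ∧ 0 < p.2.1 ∧ 0 < p.2.2 ∧
    (2 * Real.cosh (p.1 / 2)) ^ 2 + (2 * Real.cosh (p.2.1 / 2)) ^ 2
      + (2 * Real.cosh (p.2.2 / 2)) ^ 2
      - (2 * Real.cosh (p.1 / 2)) * (2 * Real.cosh (p.2.1 / 2)) * (2 * Real.cosh (p.2.2 / 2))
      = 2 - 2 * Real.cosh (L / 2)}

end

end OneHoledTorus

/-!
# The minimal length of `a² bⁿ` on one-holed tori

The proof puts every marked one-holed torus into a normal form in which all lengths are explicit.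
In the hyperboloid model, a translation along a geodesic through `i` is a symmetric matrix
`symm p q` of determinant `1`, determined by a vector `(p, q)` along its axis. Moving the
intersection of the axes of `a` and `b` to `i`, the holonomy becomes a pair of vectors. The trace of
the commutator is `2 - 4 D²` with `D` the determinant of these vectors, so that
`|D| = cosh (L / 4)`; a reflection and a rotation about `i` then make the pair a positive definite
symmetric matrix with entries `m`, `q`, `k`, by polar decomposition (`exists_conj_rep`).

Conversely, each such matrix with `m k - q² = cosh (L / 4)` comes from a torus (`normalForm`). Four
half-planes, bounded by geodesics through the points at half the translation length of `a^{±1}` and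
`b^{±1}` on their axes and perpendicular to the coordinate directions, are disjoint exactly because
`m k ≥ 1 + q²` (`sides_disjoint`). The ping-pong argument (`PingPong.eq_letter`) shows that the
closed common exterior of the half-planes meets only its translates by the generators, along the
sides. Hence the action is free and properly discontinuous. Moreover every point of an axis can be
moved into this exterior by a power of the generator, so simplicity of `a` and `b` and their single
intersection reduce to what happens inside the exterior, where the two axes meet only in `i`.

In Fenchel–Nielsen parameters `(β, τ)` with `L_b = 2 β`, which determine the torus
(`eq_of_fenchelNielsen`) and take all values (`exists_of_fenchelNielsen`), and with
`C = cosh (L / 4)`, `g² = 1 + (C / sinh β)²`, the length `ℓ` of `a² bⁿ` is given by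
`sinh² (ℓ / 4) = (g sinh (τ + n β / 2))² + (C cosh (n β / 2) / sinh β)²` (`sinh_sq_length_word`).
The first term vanishes exactly for `τ = -n β / 2`, and `cosh (n β / 2) / sinh β` has a unique strict
minimum, at the zero of its derivative, which is the equation for `L_b`.
-/

namespace OneHoledTorus

/-! ### Möbius transformations in hyperboloid coordinates -/

/-- The isometry of the upper half-plane given by a real Möbius transformation. -/
noncomputable def moebius : SL(2, ℝ) →* (ℍ ≃ᵢ ℍ) where
  toFun M := IsometryEquiv.constSMul M
  map_one' := by ext1 z; simp
  map_mul' M N := by ext1 z; simp [mul_smul]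

@[simp] theorem moebius_apply (M : SL(2, ℝ)) (z : ℍ) : moebius M z = M • z := rfl

/-- The first entry of the symmetric positive definite matrix `![![N, R], ![R, J]]` of determinant
`1` attached to a point of the hyperbolic plane; a Möbius transformation `M` acts on these matrices
by congruence. -/
noncomputable def coordN (z : ℍ) : ℝ := (z.re ^ 2 + z.im ^ 2) / z.im

/-- The off-diagonal entry of the symmetric matrix attached to a point of the hyperbolic plane. -/
noncomputable def coordR (z : ℍ) : ℝ := z.re / z.im

/-- The last entry of the symmetric matrix attached to a point of the hyperbolic plane. -/
noncomputable def coordJ (z : ℍ) : ℝ := 1 / z.im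

theorem coordJ_pos (z : ℍ) : 0 < coordJ z := by
  have := z.im_pos
  unfold coordJ; positivity

theorem coordN_pos (z : ℍ) : 0 < coordN z := by
  have := z.im_pos
  unfold coordN; positivity

theorem coordN_mul_coordJ (z : ℍ) : coordN z * coordJ z = 1 + coordR z ^ 2 := by
  have := z.im_pos.ne'
  unfold coordN coordJ coordR; field_simp; ring

theorem ext_coord {z w : ℍ} (hR : coordR z = coordR w) (hJ : coordJ z = coordJ w) : z = w := by
  have hz := z.im_pos.ne'
  have hw := w.im_pos.ne'
  unfold coordR at hR
  unfold coordJ at hJ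
  have h1 : z.im = w.im := by field_simp at hJ; exact hJ.symm
  have h2 : z.re = w.re := by rw [h1] at hR; field_simp at hR; exact hR
  exact UpperHalfPlane.ext (Complex.ext h2 h1)

theorem det_eq (M : SL(2, ℝ)) : M 0 0 * M 1 1 - M 0 1 * M 1 0 = 1 := by
  have := M.det_coe
  rwa [Matrix.det_fin_two] at this

theorem moebius_re_im (M : SL(2, ℝ)) (z : ℍ) :
    0 < (M 1 0 * z.re + M 1 1) ^ 2 + (M 1 0 * z.im) ^ 2 ∧
    (M • z).re = ((M 0 0 * z.re + M 0 1) * (M 1 0 * z.re + M 1 1) + M 0 0 * M 1 0 * z.im ^ 2) /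
      ((M 1 0 * z.re + M 1 1) ^ 2 + (M 1 0 * z.im) ^ 2) ∧
    (M • z).im = z.im / ((M 1 0 * z.re + M 1 1) ^ 2 + (M 1 0 * z.im) ^ 2) := by
  have hd := det_eq M
  have hz := z.im_pos
  have hpos : 0 < (M 1 0 * z.re + M 1 1) ^ 2 + (M 1 0 * z.im) ^ 2 := by
    by_cases hc : M 1 0 = 0
    · have : M 1 1 ≠ 0 := by rintro h; rw [hc, h] at hd; norm_num at hd
      rw [hc]; simp; positivity
    · positivity
  refine ⟨hpos, ?_, ?_⟩
  · have h := congrArg (fun w : ℍ => (w : ℂ).re) (UpperHalfPlane.specialLinearGroup_apply M z)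
    simp only [Algebra.algebraMap_self, RingHom.id_apply] at h
    rw [Complex.div_re] at h
    simp [Complex.normSq_apply] at h
    rw [h, ← add_div]
    congr 1 <;> ring
  · have h := congrArg (fun w : ℍ => (w : ℂ).im) (UpperHalfPlane.specialLinearGroup_apply M z)
    simp only [Algebra.algebraMap_self, RingHom.id_apply] at h
    rw [Complex.div_im] at h
    simp [Complex.normSq_apply] at h
    rw [h, ← sub_div]
    congr 1
    · linear_combination z.im * hd
    · ring

theorem coordJ_smul (M : SL(2, ℝ)) (z : ℍ) :
    coordJ (M • z) =
      M 1 0 ^ 2 * coordN z + 2 * (M 1 0 * M 1 1) * coordR z + M 1 1 ^ 2 * coordJ z := by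
  obtain ⟨hpos, -, him⟩ := moebius_re_im M z
  have := z.im_pos.ne'
  unfold coordN coordJ coordR
  rw [him]; field_simp; ring

theorem coordR_smul (M : SL(2, ℝ)) (z : ℍ) :
    coordR (M • z) = M 0 0 * M 1 0 * coordN z + (M 0 0 * M 1 1 + M 0 1 * M 1 0) * coordR z
      + M 0 1 * M 1 1 * coordJ z := by
  obtain ⟨hpos, hre, him⟩ := moebius_re_im M z
  have := z.im_pos.ne'
  unfold coordN coordJ coordR
  have hne := hpos.ne'
  rw [him, hre, div_div_div_cancel_right₀ hne]; field_simp; ring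

theorem moebius_neg (M : SL(2, ℝ)) : moebius (-M) = moebius M := by
  ext1 z
  apply ext_coord <;> simp [coordR_smul, coordJ_smul]

theorem coordN_smul (M : SL(2, ℝ)) (z : ℍ) :
    coordN (M • z) =
      M 0 0 ^ 2 * coordN z + 2 * (M 0 0 * M 0 1) * coordR z + M 0 1 ^ 2 * coordJ z := by
  have h := coordN_mul_coordJ (M • z)
  have h1 := coordN_mul_coordJ z
  have hd := det_eq M
  have hJ := (coordJ_pos (M • z)).ne'
  apply mul_right_cancel₀ hJ
  rw [h, coordR_smul, coordJ_smul]
  linear_combination (-(M 0 0 * M 1 1 - M 0 1 * M 1 0) - 1) * hd -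
    (M 0 0 * M 1 1 - M 0 1 * M 1 0) ^ 2 * h1

theorem cosh_dist_coord (z w : ℍ) : Real.cosh (dist z w) =
    (coordN z * coordJ w + coordJ z * coordN w) / 2 - coordR z * coordR w := by
  have hz := z.im_pos.ne'
  have hw := w.im_pos.ne'
  rw [UpperHalfPlane.cosh_dist']
  unfold coordN coordJ coordR
  field_simp; ring

/-! ### Translation lengths and axes -/

/-- The linear form on the hyperboloid attached to the traceless part of `M`. Its square measures by
how much `M` moves a point farther than the trace requires (`cosh_dist_smul`); if `M` is
hyperbolic, its zero set is the axis of `M`. -/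
noncomputable def axisForm (M : SL(2, ℝ)) (z : ℍ) : ℝ :=
  M 1 0 * coordN z + (M 1 1 - M 0 0) * coordR z - M 0 1 * coordJ z

/-- The trace of a matrix in `SL(2, ℝ)`. -/
def tr (M : SL(2, ℝ)) : ℝ := M 0 0 + M 1 1

theorem cosh_dist_smul (M : SL(2, ℝ)) (z : ℍ) :
    Real.cosh (dist z (M • z)) = (tr M ^ 2 - 2) / 2 + axisForm M z ^ 2 / 2 := by
  rw [cosh_dist_coord, coordN_smul, coordR_smul, coordJ_smul]
  have h1 := coordN_mul_coordJ z
  have hd := det_eq M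
  unfold axisForm tr
  linear_combination (((M 0 0) ^ 2 + (M 1 1) ^ 2 + 2 * M 0 1 * M 1 0) / 2) * h1
    - hd

theorem exists_coord (x : ℝ) {y : ℝ} (hy : 0 < y) :
    ∃ z : ℍ, coordN z = (x ^ 2 + y ^ 2) / y ∧ coordR z = x / y ∧ coordJ z = 1 / y :=
  ⟨⟨⟨x, y⟩, hy⟩, rfl, rfl, rfl⟩

/-- The infimum of `axisForm M ^ 2` is `0` for `M` not elliptic; it is not attained if `M` is
parabolic. -/
theorem exists_axisForm_sq_lt (M : SL(2, ℝ)) (hM : 2 ≤ |tr M|) {ε : ℝ} (hε : 0 < ε) :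
    ∃ z : ℍ, axisForm M z ^ 2 < ε := by
  have hd := det_eq M
  have htr : 4 ≤ tr M ^ 2 := by nlinarith [sq_abs (tr M)]
  obtain ⟨D, hD⟩ : ∃ D, D = (M 1 1 - M 0 0) ^ 2 + 4 * M 0 1 * M 1 0 := ⟨_, rfl⟩
  have hdisc : 0 ≤ D := by
    unfold tr at htr; linarith
  unfold axisForm
  by_cases hc : M 1 0 = 0
  · by_cases he : M 1 1 - M 0 0 = 0
    · obtain ⟨z, -, -, h3⟩ := exists_coord 0
        (show 0 < (|M 0 1| + 1) / √ε by have := Real.sqrt_pos.2 hε; positivity)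
      refine ⟨z, ?_⟩
      rw [hc, he, h3]
      have h0 : (0 : ℝ) ≤ |M 0 1| := abs_nonneg _
      have h1 : (M 0 1 * (1 / ((|M 0 1| + 1) / √ε))) ^ 2 =
          ε * (|M 0 1| ^ 2 / (|M 0 1| + 1) ^ 2) := by
        rw [sq_abs, mul_pow, one_div_div, div_pow, Real.sq_sqrt hε.le]; ring
      have h2 : |M 0 1| ^ 2 / (|M 0 1| + 1) ^ 2 < 1 := by
        rw [div_lt_one (by positivity)]; nlinarith
      calc _ = (M 0 1 * (1 / ((|M 0 1| + 1) / √ε))) ^ 2 := by ring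
        _ < ε := by rw [h1]; nlinarith
    · obtain ⟨z, -, h2, h3⟩ := exists_coord (M 0 1 / (M 1 1 - M 0 0)) one_pos
      refine ⟨z, ?_⟩
      rw [hc, h2, h3]
      have : 0 * coordN z + (M 1 1 - M 0 0) * (M 0 1 / (M 1 1 - M 0 0) / 1) - M 0 1 * (1 / 1)
          = 0 := by field_simp; ring
      rw [this]; simpa using hε
  · -- The point of height `y` over the centre of the axis, where `y` slightly exceeds the radius.
    obtain ⟨y, hy0, hy⟩ : ∃ y : ℝ, 0 < y ∧ (M 1 0 * y) ^ 2 = D / 4 + ε / 2 := by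
      refine ⟨√(D / 4 + ε / 2) / |M 1 0|, by positivity, ?_⟩
      rw [mul_pow, div_pow, sq_abs, Real.sq_sqrt (by positivity)]; field_simp
    obtain ⟨z, h1, h2, h3⟩ := exists_coord ((M 0 0 - M 1 1) / (2 * M 1 0)) hy0
    refine ⟨z, ?_⟩
    have hpos : 0 < (M 1 0 * y) ^ 2 := by positivity
    have key : M 1 0 * coordN z + (M 1 1 - M 0 0) * coordR z - M 0 1 * coordJ z =
        (ε / 2) / (M 1 0 * y) := by
      have h4 : ε / 2 = (M 1 0 * y) ^ 2 - ((M 1 1 - M 0 0) ^ 2 + 4 * M 0 1 * M 1 0) / 4 := by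
        rw [← hD]; linarith
      rw [h1, h2, h3, h4]; field_simp; ring
    rw [key, div_pow, div_lt_iff₀ hpos, hy]
    nlinarith

/-- The translation length of a Möbius transformation that is not elliptic. -/
theorem cosh_translationLength (M : SL(2, ℝ)) (hM : 2 ≤ |tr M|) :
    Real.cosh (translationLength (moebius M)) = (tr M ^ 2 - 2) / 2 := by
  have hbdd : BddBelow (Set.range fun z : ℍ => dist z (moebius M z)) :=
    ⟨0, by rintro _ ⟨z, rfl⟩; exact dist_nonneg⟩
  have hnn : 0 ≤ translationLength (moebius M) := Real.iInf_nonneg fun z => dist_nonneg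
  have htr : 4 ≤ tr M ^ 2 := by nlinarith [sq_abs (tr M)]
  have h1 : 1 ≤ (tr M ^ 2 - 2) / 2 := by linarith
  apply le_antisymm
  · apply le_of_forall_pos_le_add
    intro ε hε
    obtain ⟨z, hz⟩ := exists_axisForm_sq_lt M hM hε
    have h2 : translationLength (moebius M) ≤ dist z (M • z) := ciInf_le hbdd z
    have h3 : Real.cosh (translationLength (moebius M)) ≤ Real.cosh (dist z (M • z)) := by
      rw [Real.cosh_le_cosh, abs_of_nonneg hnn, abs_of_nonneg dist_nonneg]; exact h2
    rw [cosh_dist_smul] at h3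
    linarith
  · have h2 : Real.arcosh ((tr M ^ 2 - 2) / 2) ≤ translationLength (moebius M) := by
      apply le_ciInf
      intro z
      have h3 : Real.arcosh (Real.cosh (dist z (M • z))) = dist z (M • z) :=
        Real.arcosh_cosh dist_nonneg
      rw [moebius_apply, ← h3]
      apply (Real.arcosh_le_arcosh (by linarith) (Real.cosh_pos _)).2
      rw [cosh_dist_smul]
      nlinarith [sq_nonneg (axisForm M z)]
    have h4 := Real.cosh_arcosh h1
    rw [← h4, Real.cosh_le_cosh, abs_of_nonneg hnn, abs_of_nonneg (Real.arcosh_nonneg h1)]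
    exact h2

theorem translationLength_nonneg (f : ℍ ≃ᵢ ℍ) : 0 ≤ translationLength f :=
  Real.iInf_nonneg fun _ => dist_nonneg

theorem cosh_half_translationLength (M : SL(2, ℝ)) (hM : 2 ≤ |tr M|) :
    Real.cosh (translationLength (moebius M) / 2) = |tr M| / 2 := by
  have h := cosh_translationLength M hM
  have h2 := Real.cosh_two_mul (translationLength (moebius M) / 2)
  rw [mul_div_cancel₀ _ two_ne_zero, h, Real.sinh_sq] at h2
  have h3 := Real.cosh_pos (translationLength (moebius M) / 2)
  rw [← sq_abs (tr M)] at h2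
  nlinarith [abs_nonneg (tr M)]

theorem mem_axis_iff (M : SL(2, ℝ)) (hM : 2 ≤ |tr M|) (z : ℍ) :
    z ∈ axis (moebius M) ↔ axisForm M z = 0 := by
  have h := cosh_translationLength M hM
  have h2 := cosh_dist_smul M z
  change dist z (M • z) = translationLength (moebius M) ↔ _
  constructor
  · intro h3
    rw [h3, h] at h2
    nlinarith
  · intro h3
    rw [h3] at h2
    have h4 : Real.cosh (dist z (M • z)) = Real.cosh (translationLength (moebius M)) := by
      rw [h, h2]; ring
    exact Real.cosh_injOn dist_nonneg (translationLength_nonneg _) h4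

/-- An elliptic Möbius transformation has a fixed point. -/
theorem exists_fixed_point (M : SL(2, ℝ)) (hM : |tr M| < 2) : ∃ z : ℍ, moebius M z = z := by
  have hd := det_eq M
  have htr : tr M ^ 2 < 4 := by nlinarith [sq_abs (tr M), abs_nonneg (tr M)]
  have hdisc : 0 < -((M 1 1 - M 0 0) ^ 2 + 4 * M 0 1 * M 1 0) := by
    unfold tr at htr; linarith
  have hc : M 1 0 ≠ 0 := by
    intro h; rw [h] at hdisc; nlinarith [sq_nonneg (M 1 1 - M 0 0)]
  obtain ⟨y, hy0, hy⟩ : ∃ y : ℝ, 0 < y ∧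
      (M 1 0 * y) ^ 2 = -((M 1 1 - M 0 0) ^ 2 + 4 * M 0 1 * M 1 0) / 4 := by
    refine ⟨√(-((M 1 1 - M 0 0) ^ 2 + 4 * M 0 1 * M 1 0) / 4) / |M 1 0|, by positivity, ?_⟩
    rw [mul_pow, div_pow, sq_abs, Real.sq_sqrt (by positivity)]; field_simp
  obtain ⟨z, h1, h2, h3⟩ := exists_coord ((M 0 0 - M 1 1) / (2 * M 1 0)) hy0
  have hN : M 1 0 * coordN z = -(M 0 1) / y := by
    rw [h1]
    have h5 : M 1 0 * (((M 0 0 - M 1 1) / (2 * M 1 0)) ^ 2 + y ^ 2) = - M 0 1 := by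
      have h6 : (M 1 0 * y) ^ 2 + (M 1 1 - M 0 0) ^ 2 / 4 + M 0 1 * M 1 0 = 0 := by
        rw [hy]; ring
      apply mul_left_cancel₀ hc
      field_simp
      linear_combination 4 * h6
    rw [← mul_div_assoc, h5]
  have hR : 2 * M 1 0 * coordR z = (M 0 0 - M 1 1) / y := by
    rw [h2]; field_simp
  have hR' := coordR_smul M z
  have hJ' := coordJ_smul M z
  refine ⟨z, ext_coord ?_ ?_⟩
  · rw [moebius_apply, hR']
    have : M 0 0 * M 1 0 * coordN z = M 0 0 * (M 1 0 * coordN z) := by ring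
    rw [this, hN, h3]
    have h7 : M 0 1 * M 1 0 * coordR z = M 0 1 * ((M 0 0 - M 1 1) / y) / 2 := by
      rw [← hR]; ring
    linear_combination coordR z * hd + 2 * h7
  · rw [moebius_apply, hJ']
    have : M 1 0 ^ 2 * coordN z = M 1 0 * (M 1 0 * coordN z) := by ring
    rw [this, hN, h3]
    linear_combination M 1 1 * hR + hd / y

/-! ### Ping-pong with four half-planes -/

/-- A Schottky-type configuration for an action `ρ` of the free group on the hyperbolic plane: the
half-planes `{f l ≤ 0}`, one for each letter `l` (a generator, tagged `true`, or its inverse, tagged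
`false`), are pairwise disjoint, and `l` maps the exterior of the half-plane of `l⁻¹` onto the
half-plane of `l`. The axes of the two generators meet in the base point `o` only, and each avoids
the half-planes of the other generator. A point of the axis of a generator that neither the
generator nor its inverse brings closer to `o` lies in the common exterior. -/
structure PingPong (ρ : Pi1 →* (ℍ ≃ᵢ ℍ)) (f : Fin 2 × Bool → ℍ → ℝ) (o : ℍ) : Prop where
  flip : ∀ i z, f (i, true) (ρ (FreeGroup.of i) z) = -f (i, false) z
  disj : ∀ l l' z, l ≠ l' → f l z ≤ 0 → 0 < f l' z
  cont : ∀ l, Continuous (f l)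
  base : ∀ l, 0 < f l o
  off_axis : ∀ i j b z, i ≠ j → z ∈ axis (ρ (FreeGroup.of i)) → 0 < f (j, b) z
  nonneg_of_dist_le : ∀ i z, z ∈ axis (ρ (FreeGroup.of i)) →
    dist o z ≤ dist o (ρ (FreeGroup.of i) z) → 0 ≤ f (i, false) z
  nonneg_of_dist_inv_le : ∀ i z, z ∈ axis (ρ (FreeGroup.of i)) →
    dist o z ≤ dist o (ρ (FreeGroup.of i)⁻¹ z) → 0 ≤ f (i, true) z
  cross : axis (ρ (FreeGroup.of 0)) ∩ axis (ρ (FreeGroup.of 1)) = {o}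

theorem apply_mem_axis_iff {φ ψ : ℍ ≃ᵢ ℍ} (h : Commute φ ψ) (z : ℍ) :
    φ z ∈ axis ψ ↔ z ∈ axis ψ := by
  change dist (φ z) (ψ (φ z)) = _ ↔ dist z (ψ z) = _
  rw [← IsometryEquiv.mul_apply, ← h.eq, IsometryEquiv.mul_apply, φ.dist_eq]

namespace PingPong

variable {ρ : Pi1 →* (ℍ ≃ᵢ ℍ)} {f : Fin 2 × Bool → ℍ → ℝ} {o : ℍ}

theorem flip_letter (h : PingPong ρ f o) (i : Fin 2) (b : Bool) (z : ℍ) :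
    f (i, b) (ρ (FreeGroup.mk [(i, b)]) z) = -f (i, !b) z := by
  cases b
  · have h1 := h.flip i (ρ (FreeGroup.of i)⁻¹ z)
    have h2 : ρ (FreeGroup.of i) (ρ (FreeGroup.of i)⁻¹ z) = z := by
      rw [← IsometryEquiv.mul_apply, ← map_mul]; simp
    rw [h2] at h1
    have h3 : FreeGroup.mk [(i, false)] = (FreeGroup.of i)⁻¹ := rfl
    rw [h3]
    simp only [Bool.not_false]
    linarith
  · exact h.flip i z

/-- A nontrivial reduced word sends the common exterior into the half-plane of its first letter. -/
theorem apply_word_nonpos (h : PingPong ρ f o) (w : List (Fin 2 × Bool)) (l : Fin 2 × Bool)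
    (hw : FreeGroup.IsReduced (l :: w)) (z : ℍ) (hz : ∀ l, 0 ≤ f l z) :
    f l (ρ (FreeGroup.mk (l :: w)) z) ≤ 0 ∧ (w ≠ [] → f l (ρ (FreeGroup.mk (l :: w)) z) < 0) := by
  induction w generalizing l with
  | nil =>
    refine ⟨?_, fun h => absurd rfl h⟩
    obtain ⟨i, b⟩ := l
    rw [h.flip_letter]
    linarith [hz (i, !b)]
  | cons l' w ih =>
    rw [FreeGroup.isReduced_cons_cons] at hw
    have h1 := (ih l' hw.2).1
    obtain ⟨i, b⟩ := l
    have hmul : FreeGroup.mk ((i, b) :: l' :: w) =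
        FreeGroup.mk [(i, b)] * FreeGroup.mk (l' :: w) := by rw [FreeGroup.mul_mk]; rfl
    have hne : l' ≠ (i, !b) := by
      rintro rfl
      have := hw.1 rfl
      cases b <;> simp at this
    have h2 := h.disj _ _ _ hne h1
    have h3 : f (i, b) (ρ (FreeGroup.mk ((i, b) :: l' :: w)) z) < 0 := by
      rw [hmul, map_mul, IsometryEquiv.mul_apply, h.flip_letter]
      linarith
    exact ⟨h3.le, fun _ => h3⟩

/-- The closed common exterior of the half-planes meets only its translates by the letters, and
these along the sides. -/
theorem eq_letter (h : PingPong ρ f o) {g : Pi1} (hg : g ≠ 1) {z : ℍ} (hz : ∀ l, 0 ≤ f l z)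
    (hgz : ∀ l, 0 ≤ f l (ρ g z)) :
    ∃ i b, g = FreeGroup.mk [(i, b)] ∧ f (i, b) (ρ g z) = 0 ∧ f (i, !b) z = 0 := by
  have hmk : FreeGroup.mk g.toWord = g := FreeGroup.mk_toWord
  have hred : FreeGroup.IsReduced g.toWord := FreeGroup.isReduced_toWord
  rcases hw : g.toWord with _ | ⟨⟨i, b⟩, w⟩
  · exact absurd (FreeGroup.toWord_eq_nil_iff.1 hw) hg
  · rw [hw] at hmk hred
    have h1 := h.apply_word_nonpos w (i, b) hred z hz
    rw [hmk] at h1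
    have h2 : w = [] := by
      by_contra hne
      exact absurd (hgz (i, b)) (not_le.2 (h1.2 hne))
    subst h2
    have h3 : f (i, b) (ρ g z) = 0 := le_antisymm h1.1 (hgz _)
    refine ⟨i, b, hmk.symm, h3, ?_⟩
    rw [← hmk, h.flip_letter] at h3
    linarith

theorem exists_pos_le_dist (h : PingPong ρ f o) :
    ∃ r > 0, ∀ g : Pi1, g ≠ 1 → r ≤ dist o (ρ g o) := by
  have hopen : IsOpen {z : ℍ | ∀ l, 0 < f l z} := by
    rw [Set.ofPred_forall]
    exact isOpen_iInter_of_finite fun l => isOpen_lt continuous_const (h.cont l)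
  obtain ⟨r, hr, hball⟩ := Metric.isOpen_iff.1 hopen o h.base
  refine ⟨r, hr, fun g hg => ?_⟩
  by_contra! hlt
  have hmem : ρ g o ∈ {z : ℍ | ∀ l, 0 < f l z} := hball (by rwa [Metric.mem_ball, dist_comm])
  obtain ⟨i, b, -, h0, -⟩ := h.eq_letter hg (fun l => (h.base l).le) (fun l => (hmem l).le)
  exact (hmem (i, b)).ne' h0

theorem finite_dist_le (h : PingPong ρ f o) (R : ℝ) : {g : Pi1 | dist o (ρ g o) ≤ R}.Finite := by
  obtain ⟨r, hr, hsep⟩ := h.exists_pos_le_dist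
  obtain ⟨t, ht, hcov⟩ := Metric.totallyBounded_iff.1
    (isCompact_closedBall o R).totallyBounded (r / 2) (half_pos hr)
  refine (ht.biUnion (t := fun y => {g : Pi1 | ρ g o ∈ Metric.ball y (r / 2)})
    fun y _ => Set.Subsingleton.finite ?_).subset ?_
  · intro g hg g' hg'
    by_contra hne
    have h1 := hsep (g⁻¹ * g') (by rwa [ne_eq, inv_mul_eq_one])
    have h2 : dist o (ρ (g⁻¹ * g') o) = dist (ρ g o) (ρ g' o) := by
      rw [← (ρ g).dist_eq o, ← IsometryEquiv.mul_apply, ← map_mul, mul_inv_cancel_left]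
    have h3 := dist_triangle_right (ρ g o) (ρ g' o) y
    have h4 : dist (ρ g o) y < r / 2 := hg
    have h5 : dist (ρ g' o) y < r / 2 := hg'
    linarith
  · intro g hg
    have := hcov (show ρ g o ∈ Metric.closedBall o R by
      rw [Metric.mem_closedBall, dist_comm]; exact hg)
    simpa using this

/-- Proper discontinuity, because the orbit of `o` is uniformly discrete. -/
theorem properly_discontinuous (h : PingPong ρ f o) (K : Set ℍ) (hK : IsCompact K) :
    {g : Pi1 | ((ρ g '' K) ∩ K).Nonempty}.Finite := by
  obtain ⟨R, hR⟩ := hK.isBounded.subset_closedBall o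
  refine (h.finite_dist_le (R + R)).subset ?_
  rintro g ⟨_, ⟨z, hz, rfl⟩, hgz⟩
  have h1 : dist z o ≤ R := hR hz
  have h2 : dist (ρ g z) o ≤ R := hR hgz
  have h3 := dist_triangle_left o (ρ g o) (ρ g z)
  rw [(ρ g).dist_eq] at h3
  exact h3.trans (add_le_add h2 h1)

/-- Freeness: a nontrivial stabilizer would be infinite, since the free group is torsion-free, which
contradicts proper discontinuity. -/
theorem free (h : PingPong ρ f o) (g : Pi1) (z : ℍ) (hz : ρ g z = z) : g = 1 := by
  by_contra hg
  have hinj : Function.Injective fun n : ℕ => g ^ n :=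
    injective_pow_iff_not_isOfFinOrder.2 (not_isOfFinOrder_of_isMulTorsionFree hg)
  refine Set.infinite_of_injective_forall_mem hinj (fun n => ?_)
    (h.properly_discontinuous {z} isCompact_singleton)
  refine ⟨z, ⟨z, rfl, ?_⟩, rfl⟩
  induction n with
  | zero => simp
  | succ n ih =>
    rw [pow_succ, map_mul, IsometryEquiv.mul_apply, hz]
    exact ih

theorem commute_of_mem_zpowers {c g : Pi1} (hg : g ∈ Subgroup.zpowers c) :
    Commute (ρ g) (ρ c) := by
  obtain ⟨n, rfl⟩ := hg
  exact ((Commute.refl c).zpow_left n).map ρ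

/-- Each point of the axis of a generator has a translate by a power of this generator in the
closed common exterior of the half-planes: the translate closest to `o`. -/
theorem exists_zpow_nonneg (h : PingPong ρ f o) (i : Fin 2) {z : ℍ}
    (hz : z ∈ axis (ρ (FreeGroup.of i))) :
    ∃ g ∈ Subgroup.zpowers (FreeGroup.of i), ∀ l, 0 ≤ f l (ρ g z) := by
  have hfin : {g : Pi1 | g ∈ Subgroup.zpowers (FreeGroup.of i) ∧
      dist o (ρ g z) ≤ dist o z}.Finite := by
    refine (h.finite_dist_le (dist o z + dist o z)).subset ?_
    rintro g ⟨-, hg⟩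
    have h3 := dist_triangle_right o (ρ g o) (ρ g z)
    rw [(ρ g).dist_eq] at h3
    exact h3.trans (add_le_add hg le_rfl)
  obtain ⟨g, ⟨hg, hgz⟩, hmin⟩ := Set.exists_min_image _ (fun g => dist o (ρ g z)) hfin
    ⟨1, one_mem _, by simp⟩
  have hmin' : ∀ g' ∈ Subgroup.zpowers (FreeGroup.of i),
      dist o (ρ g z) ≤ dist o (ρ g' (ρ g z)) := by
    intro g' hg'
    rw [← IsometryEquiv.mul_apply, ← map_mul]
    by_cases hle : dist o (ρ (g' * g) z) ≤ dist o z
    · exact hmin _ ⟨mul_mem hg' hg, hle⟩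
    · exact hgz.trans (not_le.1 hle).le
  have hax : ρ g z ∈ axis (ρ (FreeGroup.of i)) :=
    (apply_mem_axis_iff (commute_of_mem_zpowers hg) z).2 hz
  refine ⟨g, hg, ?_⟩
  rintro ⟨j, b⟩
  by_cases hij : i = j
  · subst hij
    cases b
    · exact h.nonneg_of_dist_le i _ hax (hmin' _ (Subgroup.mem_zpowers _))
    · exact h.nonneg_of_dist_inv_le i _ hax
        (hmin' _ (inv_mem (Subgroup.mem_zpowers _)))
  · exact (h.off_axis i j b _ hij hax).le

theorem letter_mem_zpowers (i : Fin 2) (b : Bool) :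
    (FreeGroup.mk [(i, b)] : Pi1) ∈ Subgroup.zpowers (FreeGroup.of i) := by
  cases b
  · exact inv_mem (Subgroup.mem_zpowers (FreeGroup.of i))
  · exact Subgroup.mem_zpowers (FreeGroup.of i)

theorem simple (h : PingPong ρ f o) (i : Fin 2) (g : Pi1) :
    ρ g '' axis (ρ (FreeGroup.of i)) = axis (ρ (FreeGroup.of i)) ∨
      Disjoint (ρ g '' axis (ρ (FreeGroup.of i))) (axis (ρ (FreeGroup.of i))) := by
  rw [or_iff_not_imp_right, Set.not_disjoint_iff]
  rintro ⟨_, ⟨v, hv, rfl⟩, hw⟩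
  obtain ⟨u, hu, hud⟩ := h.exists_zpow_nonneg i hv
  obtain ⟨u', hu', hud'⟩ := h.exists_zpow_nonneg i hw
  have hax := (apply_mem_axis_iff (commute_of_mem_zpowers hu) v).2 hv
  have hax' := (apply_mem_axis_iff (commute_of_mem_zpowers hu') _).2 hw
  have heq : ρ (u' * g * u⁻¹) (ρ u v) = ρ u' (ρ g v) := by
    simp only [← IsometryEquiv.mul_apply, ← map_mul, inv_mul_cancel_right]
  have hmem : u' * g * u⁻¹ ∈ Subgroup.zpowers (FreeGroup.of i) := by
    by_cases h1 : u' * g * u⁻¹ = 1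
    · rw [h1]; exact one_mem _
    · obtain ⟨j, b, hlet, h0, -⟩ := h.eq_letter h1 hud (by rw [heq]; exact hud')
      have hij : i = j := by
        by_contra hij
        rw [heq] at h0
        exact (h.off_axis i j b _ hij hax').ne' h0
      rw [hlet, hij]
      exact letter_mem_zpowers j b
  have hg : g ∈ Subgroup.zpowers (FreeGroup.of i) := by
    have := mul_mem (mul_mem (inv_mem hu') hmem) hu
    simpa [mul_assoc] using this
  ext w
  constructor
  · rintro ⟨v, hv, rfl⟩
    exact (apply_mem_axis_iff (commute_of_mem_zpowers hg) v).2 hv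
  · intro hw
    refine ⟨ρ g⁻¹ w, (apply_mem_axis_iff (commute_of_mem_zpowers (inv_mem hg)) w).2 hw, ?_⟩
    rw [← IsometryEquiv.mul_apply, ← map_mul]; simp

theorem meet_once (h : PingPong ρ f o) (g : Pi1) (w : ℍ)
    (hw : w ∈ axis (ρ (FreeGroup.of 0)) ∩ ρ g '' axis (ρ (FreeGroup.of 1))) :
    ∃ u, w = ρ u o := by
  obtain ⟨hw, v, hv, rfl⟩ := hw
  obtain ⟨u, hu, hud⟩ := h.exists_zpow_nonneg 1 hv
  obtain ⟨u', hu', hud'⟩ := h.exists_zpow_nonneg 0 hw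
  have hax := (apply_mem_axis_iff (commute_of_mem_zpowers hu) v).2 hv
  have hax' := (apply_mem_axis_iff (commute_of_mem_zpowers hu') _).2 hw
  have heq : ρ (u' * g * u⁻¹) (ρ u v) = ρ u' (ρ g v) := by
    simp only [← IsometryEquiv.mul_apply, ← map_mul, inv_mul_cancel_right]
  have h1 : u' * g * u⁻¹ = 1 := by
    by_contra h1
    obtain ⟨j, b, -, h0, h0'⟩ := h.eq_letter h1 hud (by rw [heq]; exact hud')
    rw [heq] at h0
    have hj0 : 0 = j := by
      by_contra hij
      exact (h.off_axis 0 j b _ hij hax').ne' h0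
    have hj1 : 1 = j := by
      by_contra hij
      exact (h.off_axis 1 j _ _ hij hax).ne' h0'
    rw [← hj0] at hj1
    exact absurd hj1 (by decide)
  rw [h1, map_one] at heq
  change ρ u v = _ at heq
  have ho : ρ u' (ρ g v) ∈ ({o} : Set ℍ) := by
    rw [← h.cross]
    refine ⟨hax', ?_⟩
    rw [← heq]; exact hax
  refine ⟨u'⁻¹, ?_⟩
  rw [← Set.mem_singleton_iff.1 ho, ← IsometryEquiv.mul_apply, ← map_mul]
  simp

end PingPong

/-! ### Translations along geodesics through the base point -/

/-- Half the trace of the symmetric matrix with traceless part `(p, q)`. -/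
noncomputable def halfTrace (p q : ℝ) : ℝ := √(1 + p ^ 2 + q ^ 2)

theorem halfTrace_sq (p q : ℝ) : halfTrace p q ^ 2 = 1 + p ^ 2 + q ^ 2 :=
  Real.sq_sqrt (by positivity)

theorem one_le_halfTrace (p q : ℝ) : 1 ≤ halfTrace p q := by
  rw [halfTrace, Real.one_le_sqrt]; nlinarith [sq_nonneg p, sq_nonneg q]

theorem halfTrace_pos (p q : ℝ) : 0 < halfTrace p q := one_pos.trans_le (one_le_halfTrace p q)

/-- The symmetric matrix in `SL(2, ℝ)` of positive trace with traceless part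
`![![p, q], ![q, -p]]`. For `(p, q) ≠ 0` it is a translation along a geodesic through `i`, in the
direction `(p, q)` and with translation length `2 arsinh √(p² + q²)`. -/
noncomputable def symm (p q : ℝ) : SL(2, ℝ) :=
  ⟨!![halfTrace p q + p, q; q, halfTrace p q - p], by
    rw [Matrix.det_fin_two_of]; linear_combination halfTrace_sq p q⟩

@[simp] theorem symm_00 (p q : ℝ) : symm p q 0 0 = halfTrace p q + p := rfl
@[simp] theorem symm_01 (p q : ℝ) : symm p q 0 1 = q := rfl
@[simp] theorem symm_10 (p q : ℝ) : symm p q 1 0 = q := rfl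
@[simp] theorem symm_11 (p q : ℝ) : symm p q 1 1 = halfTrace p q - p := rfl

theorem sl_ext {M N : SL(2, ℝ)} (h00 : M 0 0 = N 0 0) (h01 : M 0 1 = N 0 1) (h10 : M 1 0 = N 1 0)
    (h11 : M 1 1 = N 1 1) : M = N := by
  ext i j
  fin_cases i <;> fin_cases j <;> assumption

theorem mul_00 (M N : SL(2, ℝ)) : (M * N) 0 0 = M 0 0 * N 0 0 + M 0 1 * N 1 0 := by
  simp [Matrix.mul_apply, Fin.sum_univ_two]
theorem mul_01 (M N : SL(2, ℝ)) : (M * N) 0 1 = M 0 0 * N 0 1 + M 0 1 * N 1 1 := by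
  simp [Matrix.mul_apply, Fin.sum_univ_two]
theorem mul_10 (M N : SL(2, ℝ)) : (M * N) 1 0 = M 1 0 * N 0 0 + M 1 1 * N 1 0 := by
  simp [Matrix.mul_apply, Fin.sum_univ_two]
theorem mul_11 (M N : SL(2, ℝ)) : (M * N) 1 1 = M 1 0 * N 0 1 + M 1 1 * N 1 1 := by
  simp [Matrix.mul_apply, Fin.sum_univ_two]

theorem inv_00 (M : SL(2, ℝ)) : M⁻¹ 0 0 = M 1 1 := by
  rw [Matrix.SpecialLinearGroup.coe_inv, Matrix.adjugate_fin_two]; rfl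
theorem inv_01 (M : SL(2, ℝ)) : M⁻¹ 0 1 = -M 0 1 := by
  rw [Matrix.SpecialLinearGroup.coe_inv, Matrix.adjugate_fin_two]; rfl
theorem inv_10 (M : SL(2, ℝ)) : M⁻¹ 1 0 = -M 1 0 := by
  rw [Matrix.SpecialLinearGroup.coe_inv, Matrix.adjugate_fin_two]; rfl
theorem inv_11 (M : SL(2, ℝ)) : M⁻¹ 1 1 = M 0 0 := by
  rw [Matrix.SpecialLinearGroup.coe_inv, Matrix.adjugate_fin_two]; rfl

theorem symm_inv (p q : ℝ) : (symm p q)⁻¹ = symm (-p) (-q) := by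
  have : halfTrace (-p) (-q) = halfTrace p q := by simp [halfTrace]
  apply sl_ext
  · rw [inv_00]; simp [this]; ring
  · rw [inv_01]; simp
  · rw [inv_10]; simp
  · rw [inv_11]; simp [this]

theorem tr_symm (p q : ℝ) : tr (symm p q) = 2 * halfTrace p q := by
  simp [tr]; ring

theorem two_le_abs_tr_symm (p q : ℝ) : 2 ≤ |tr (symm p q)| := by
  rw [tr_symm, abs_of_pos (by have := halfTrace_pos p q; positivity)]
  linarith [one_le_halfTrace p q]

theorem tr_symm_mul (p q r s : ℝ) : tr (symm p q * symm r s) =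
    2 * (halfTrace p q * halfTrace r s + (p * r + q * s)) := by
  simp only [tr, mul_00, mul_11, symm_00, symm_01, symm_10, symm_11]; ring

/-- Fricke's identity for the trace of a commutator. -/
theorem tr_commutator (M N : SL(2, ℝ)) : tr (M * N * M⁻¹ * N⁻¹) =
    tr M ^ 2 + tr N ^ 2 + tr (M * N) ^ 2 - tr M * tr N * tr (M * N) - 2 := by
  have h1 := det_eq M
  have h2 := det_eq N
  simp only [tr, mul_00, mul_01, mul_10, mul_11, inv_00, inv_01, inv_10, inv_11]
  linear_combination ((N 0 0 + N 1 1) ^ 2 - 2 * (N 0 0 * N 1 1 - N 0 1 * N 1 0)) * h1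
    + ((M 0 0 + M 1 1) ^ 2 - 2) * h2

theorem tr_commutator_symm (p q r s : ℝ) :
    tr (symm p q * symm r s * (symm p q)⁻¹ * (symm r s)⁻¹) = 2 - 4 * (p * s - q * r) ^ 2 := by
  rw [tr_commutator, tr_symm_mul, tr_symm, tr_symm]
  linear_combination 4 * (1 - halfTrace r s ^ 2) * halfTrace_sq p q
    - 4 * (p ^ 2 + q ^ 2) * halfTrace_sq r s

/-- The time coordinate of a point in the hyperboloid model. -/
noncomputable def time (z : ℍ) : ℝ := (coordN z + coordJ z) / 2

/-- The first space coordinate of a point in the hyperboloid model. -/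
noncomputable def spaceX (z : ℍ) : ℝ := (coordN z - coordJ z) / 2

theorem time_sq (z : ℍ) : time z ^ 2 = 1 + spaceX z ^ 2 + coordR z ^ 2 := by
  unfold time spaceX
  linear_combination coordN_mul_coordJ z

theorem time_pos (z : ℍ) : 0 < time z :=
  half_pos (add_pos (coordN_pos z) (coordJ_pos z))

theorem cosh_dist_I (z : ℍ) : Real.cosh (dist UpperHalfPlane.I z) = time z := by
  rw [cosh_dist_coord]
  simp [coordN, coordR, coordJ, time]
  ring

theorem dist_I_le_iff (z w : ℍ) :
    dist UpperHalfPlane.I z ≤ dist UpperHalfPlane.I w ↔ time z ≤ time w := by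
  rw [← cosh_dist_I, ← cosh_dist_I, Real.cosh_le_cosh, abs_of_nonneg dist_nonneg,
    abs_of_nonneg dist_nonneg]

theorem time_symm_smul (p q : ℝ) (z : ℍ) : time (symm p q • z) =
    time z + 2 * ((p ^ 2 + q ^ 2) * time z + halfTrace p q * (p * spaceX z + q * coordR z)) := by
  simp only [time, spaceX, coordN_smul, coordJ_smul, symm_00, symm_01, symm_10, symm_11]
  linear_combination (coordN z + coordJ z) / 2 * halfTrace_sq p q

theorem spaceX_symm_smul (p q : ℝ) (z : ℍ) : spaceX (symm p q • z) =
    spaceX z + 2 * p * (halfTrace p q * time z + (p * spaceX z + q * coordR z)) := by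
  simp only [time, spaceX, coordN_smul, coordJ_smul, symm_00, symm_01, symm_10, symm_11]
  linear_combination (coordN z - coordJ z) / 2 * halfTrace_sq p q

theorem coordR_symm_smul (p q : ℝ) (z : ℍ) : coordR (symm p q • z) =
    coordR z + 2 * q * (halfTrace p q * time z + (p * spaceX z + q * coordR z)) := by
  simp only [time, spaceX, coordR_smul, symm_00, symm_01, symm_10, symm_11]
  linear_combination coordR z * halfTrace_sq p q

theorem mem_axis_symm_iff (p q : ℝ) (z : ℍ) :
    z ∈ axis (moebius (symm p q)) ↔ q * spaceX z = p * coordR z := by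
  rw [mem_axis_iff _ (two_le_abs_tr_symm p q), axisForm]
  simp only [symm_00, symm_01, symm_10, symm_11, spaceX]
  constructor <;> intro h
  · linear_combination h / 2
  · linear_combination 2 * h

theorem continuous_time : Continuous time := by
  unfold time coordN coordJ
  have h1 := UpperHalfPlane.continuous_re
  have h2 := UpperHalfPlane.continuous_im
  have h3 : ∀ z : ℍ, z.im ≠ 0 := fun z => z.im_pos.ne'
  fun_prop (disch := assumption)

theorem continuous_spaceX : Continuous spaceX := by
  unfold spaceX coordN coordJ
  have h1 := UpperHalfPlane.continuous_re
  have h2 := UpperHalfPlane.continuous_im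
  have h3 : ∀ z : ℍ, z.im ≠ 0 := fun z => z.im_pos.ne'
  fun_prop (disch := assumption)

theorem continuous_coordR : Continuous coordR := by
  unfold coordR
  have h1 := UpperHalfPlane.continuous_re
  have h2 := UpperHalfPlane.continuous_im
  have h3 : ∀ z : ℍ, z.im ≠ 0 := fun z => z.im_pos.ne'
  fun_prop (disch := assumption)

theorem eq_I_of_space_eq_zero {z : ℍ} (h1 : spaceX z = 0) (h2 : coordR z = 0) :
    z = UpperHalfPlane.I := by
  rw [← dist_eq_zero, dist_comm]
  have h3 : time z = 1 := by
    have := time_sq z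
    rw [h1, h2] at this
    nlinarith [time_pos z]
  rw [← cosh_dist_I] at h3
  exact Real.cosh_injOn dist_nonneg Set.self_mem_Ici (h3.trans Real.cosh_zero.symm)

/-! ### One-holed tori in normal form -/

/-- The representation that maps the generators to translations along geodesics through `i`, in the
directions `(m, q)` and `(q, k)`. -/
noncomputable def rep (m q k : ℝ) : Pi1 →* (ℍ ≃ᵢ ℍ) :=
  moebius.comp (FreeGroup.lift ![symm m q, symm q k])

theorem rep_of_zero (m q k : ℝ) : rep m q k (FreeGroup.of 0) = moebius (symm m q) := by
  simp [rep]

theorem rep_of_one (m q k : ℝ) : rep m q k (FreeGroup.of 1) = moebius (symm q k) := by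
  simp [rep]

/-- The linear forms on the hyperboloid that define the four half-planes. The geodesic bounding
the half-plane of `a` passes through the midpoint of `i` and `a i` on the axis of `a`, and it is
symmetric about the first coordinate axis; similarly for `b` and the second coordinate axis. -/
noncomputable def sideForm (m q k : ℝ) (l : Fin 2 × Bool) (z : ℍ) : ℝ :=
  ![m, k] l.1 * time z - (if l.2 then 1 else -1) *
    ![halfTrace m q * spaceX z, halfTrace q k * coordR z] l.1

theorem sideForm_zero (m q k : ℝ) (b : Bool) (z : ℍ) : sideForm m q k (0, b) z =
    m * time z - (if b then 1 else -1) * (halfTrace m q * spaceX z) := rfl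

theorem sideForm_one (m q k : ℝ) (b : Bool) (z : ℍ) : sideForm m q k (1, b) z =
    k * time z - (if b then 1 else -1) * (halfTrace q k * coordR z) := rfl

section

variable {m q k : ℝ}

theorem sub_sign_mul_pos {u v : ℝ} (h : |v| < u) (b : Bool) :
    0 < u - (if b then 1 else -1) * v := by
  rw [abs_lt] at h
  cases b <;> simp <;> linarith

theorem le_abs_of_sub_sign_mul_nonpos {u v : ℝ} {b : Bool}
    (h : u - (if b then 1 else -1) * v ≤ 0) : u ≤ |v| := by
  by_contra! h1
  exact absurd h (not_le.2 (sub_sign_mul_pos h1 b))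

/-- A half-plane of `a` and a half-plane of `b` are disjoint; they are tangent at infinity exactly
when `m k = 1 + q²`. -/
theorem sides_disjoint (hm : 0 < m) (hk : 0 < k) (hC : 1 + q ^ 2 ≤ m * k) (z : ℍ)
    (h1 : m * time z ≤ |halfTrace m q * spaceX z|)
    (h2 : k * time z ≤ |halfTrace q k * coordR z|) : False := by
  have ht := time_pos z
  have h1' := mul_self_le_mul_self (by positivity) h1
  have h2' := mul_self_le_mul_self (by positivity) h2
  rw [abs_mul_abs_self] at h1' h2'
  have e1 := halfTrace_sq m q
  have e2 := halfTrace_sq q k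
  have e3 := time_sq z
  have hA : 0 < halfTrace m q ^ 2 := by rw [e1]; positivity
  have hB : 0 < halfTrace q k ^ 2 := by rw [e2]; positivity
  have hw : (1 + q ^ 2) ^ 2 ≤ (m * k) ^ 2 := by gcongr
  have h3 : halfTrace m q ^ 2 * halfTrace q k ^ 2 ≤
      m ^ 2 * halfTrace q k ^ 2 + k ^ 2 * halfTrace m q ^ 2 := by
    rw [e1, e2]; linarith
  have h4 := mul_le_mul_of_nonneg_left h1' hB.le
  have h5 := mul_le_mul_of_nonneg_left h2' hA.le
  have h6 := mul_le_mul_of_nonneg_right h3 (sq_nonneg (time z))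
  have h7 : 0 < halfTrace m q ^ 2 * halfTrace q k ^ 2 := mul_pos hA hB
  have h8 : halfTrace m q ^ 2 * halfTrace q k ^ 2 * time z ^ 2 =
    halfTrace m q ^ 2 * halfTrace q k ^ 2 * (1 + spaceX z ^ 2 + coordR z ^ 2) := by rw [e3]
  linarith

theorem abs_lt_of_mem_axis_a (hm : 0 < m) (hk : 0 < k) (hC : 1 + q ^ 2 ≤ m * k) {z : ℍ}
    (hz : q * spaceX z = m * coordR z) : |halfTrace q k * coordR z| < k * time z := by
  have ht := time_pos z
  apply abs_lt_of_sq_lt_sq _ (by positivity)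
  have hw : (1 + q ^ 2) ^ 2 ≤ (m * k) ^ 2 := by gcongr
  have h1 : m ^ 2 * ((k * time z) ^ 2 - (halfTrace q k * coordR z) ^ 2) =
      (m * k) ^ 2 + spaceX z ^ 2 * ((m * k) ^ 2 - (1 + q ^ 2) ^ 2 + (1 + q ^ 2)) := by
    rw [mul_pow, mul_pow, halfTrace_sq, time_sq]
    linear_combination (1 + q ^ 2) * (q * spaceX z + m * coordR z) * hz
  have h2 : 0 < m ^ 2 * ((k * time z) ^ 2 - (halfTrace q k * coordR z) ^ 2) := by
    rw [h1]
    have : 0 ≤ (m * k) ^ 2 - (1 + q ^ 2) ^ 2 + (1 + q ^ 2) := by nlinarith [sq_nonneg q]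
    positivity
  have h3 := pos_of_mul_pos_right h2 (sq_nonneg m)
  linarith

theorem abs_lt_of_mem_axis_b (hm : 0 < m) (hk : 0 < k) (hC : 1 + q ^ 2 ≤ m * k) {z : ℍ}
    (hz : k * spaceX z = q * coordR z) : |halfTrace m q * spaceX z| < m * time z := by
  have ht := time_pos z
  apply abs_lt_of_sq_lt_sq _ (by positivity)
  have hw : (1 + q ^ 2) ^ 2 ≤ (m * k) ^ 2 := by gcongr
  have h1 : k ^ 2 * ((m * time z) ^ 2 - (halfTrace m q * spaceX z) ^ 2) =
      (m * k) ^ 2 + coordR z ^ 2 * ((m * k) ^ 2 - (1 + q ^ 2) ^ 2 + (1 + q ^ 2)) := by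
    rw [mul_pow, mul_pow, halfTrace_sq, time_sq]
    linear_combination -(1 + q ^ 2) * (k * spaceX z + q * coordR z) * hz
  have h2 : 0 < k ^ 2 * ((m * time z) ^ 2 - (halfTrace m q * spaceX z) ^ 2) := by
    rw [h1]
    have : 0 ≤ (m * k) ^ 2 - (1 + q ^ 2) ^ 2 + (1 + q ^ 2) := by nlinarith [sq_nonneg q]
    positivity
  have h3 := pos_of_mul_pos_right h2 (sq_nonneg k)
  linarith

theorem pingPong_rep (hm : 0 < m) (hk : 0 < k) (hC : 1 + q ^ 2 ≤ m * k) :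
    PingPong (rep m q k) (sideForm m q k) UpperHalfPlane.I where
  flip i z := by
    fin_cases i
    · simp only [Fin.zero_eta, rep_of_zero, sideForm_zero, moebius_apply, time_symm_smul,
        spaceX_symm_smul]
      simp only [if_true, Bool.false_eq_true, if_false]
      linear_combination -2 * m * time z * halfTrace_sq m q
    · simp only [Fin.mk_one, rep_of_one, sideForm_one, moebius_apply, time_symm_smul,
        coordR_symm_smul]
      simp only [if_true, Bool.false_eq_true, if_false]
      linear_combination -2 * k * time z * halfTrace_sq q k
  disj := by
    rintro ⟨i, b⟩ ⟨j, b'⟩ z hne h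
    have ht := time_pos z
    by_contra! h'
    fin_cases i <;> fin_cases j
    · have : b' = !b := by
        rcases b <;> rcases b' <;> simp at hne ⊢
      subst this
      simp only [Fin.zero_eta, sideForm_zero] at h h'
      have := mul_pos hm ht
      cases b <;> simp at h h' <;> linarith
    · exact sides_disjoint hm hk hC z (le_abs_of_sub_sign_mul_nonpos h)
        (le_abs_of_sub_sign_mul_nonpos h')
    · exact sides_disjoint hm hk hC z (le_abs_of_sub_sign_mul_nonpos h')
        (le_abs_of_sub_sign_mul_nonpos h)
    · have : b' = !b := by
        rcases b <;> rcases b' <;> simp at hne ⊢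
      subst this
      simp only [Fin.mk_one, sideForm_one] at h h'
      have := mul_pos hk ht
      cases b <;> simp at h h' <;> linarith
  cont := by
    rintro ⟨i, b⟩
    have h1 := continuous_time
    have h2 := continuous_spaceX
    have h3 := continuous_coordR
    fin_cases i
    · exact (h1.const_mul _).sub ((h2.const_mul _).const_mul _)
    · exact (h1.const_mul _).sub ((h3.const_mul _).const_mul _)
  base := by
    rintro ⟨i, b⟩
    have h1 : time UpperHalfPlane.I = 1 := by rw [← cosh_dist_I, dist_self, Real.cosh_zero]
    have h2 : spaceX UpperHalfPlane.I = 0 := by simp [spaceX, coordN, coordJ]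
    have h3 : coordR UpperHalfPlane.I = 0 := by simp [coordR]
    fin_cases i
    · simpa [sideForm_zero, h1, h2] using hm
    · simpa [sideForm_one, h1, h3] using hk
  off_axis := by
    intro i j b z hij hz
    fin_cases i <;> fin_cases j
    · exact absurd rfl hij
    · rw [Fin.zero_eta, rep_of_zero, mem_axis_symm_iff] at hz
      exact sub_sign_mul_pos (abs_lt_of_mem_axis_a hm hk hC hz) b
    · rw [Fin.mk_one, rep_of_one, mem_axis_symm_iff] at hz
      exact sub_sign_mul_pos (abs_lt_of_mem_axis_b hm hk hC hz) b
    · exact absurd rfl hij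
  nonneg_of_dist_le := by
    intro i z hz hd
    fin_cases i
    · rw [Fin.zero_eta, rep_of_zero, mem_axis_symm_iff] at hz
      rw [dist_I_le_iff, Fin.zero_eta, rep_of_zero, moebius_apply, time_symm_smul] at hd
      simp only [Fin.zero_eta, sideForm_zero, Bool.false_eq_true, if_false]
      have h1 : (m ^ 2 + q ^ 2) * (m * time z + halfTrace m q * spaceX z) =
          m * ((m ^ 2 + q ^ 2) * time z + halfTrace m q * (m * spaceX z + q * coordR z)) := by
        linear_combination halfTrace m q * q * hz
      have h2 : 0 ≤ (m ^ 2 + q ^ 2) * (m * time z + halfTrace m q * spaceX z) := by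
        rw [h1]; apply mul_nonneg hm.le; linarith
      have h3 := nonneg_of_mul_nonneg_right h2 (by positivity)
      linarith
    · rw [Fin.mk_one, rep_of_one, mem_axis_symm_iff] at hz
      rw [dist_I_le_iff, Fin.mk_one, rep_of_one, moebius_apply, time_symm_smul] at hd
      simp only [Fin.mk_one, sideForm_one, Bool.false_eq_true, if_false]
      have h1 : (q ^ 2 + k ^ 2) * (k * time z + halfTrace q k * coordR z) =
          k * ((q ^ 2 + k ^ 2) * time z + halfTrace q k * (q * spaceX z + k * coordR z)) := by
        linear_combination -halfTrace q k * q * hz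
      have h2 : 0 ≤ (q ^ 2 + k ^ 2) * (k * time z + halfTrace q k * coordR z) := by
        rw [h1]; apply mul_nonneg hk.le; linarith
      have h3 := nonneg_of_mul_nonneg_right h2 (by positivity)
      linarith
  nonneg_of_dist_inv_le := by
    intro i z hz hd
    have hneg : ∀ p r, halfTrace (-p) (-r) = halfTrace p r := by simp [halfTrace]
    fin_cases i
    · rw [Fin.zero_eta, rep_of_zero, mem_axis_symm_iff] at hz
      rw [dist_I_le_iff, Fin.zero_eta, map_inv, rep_of_zero, ← map_inv, symm_inv, moebius_apply,
        time_symm_smul, hneg] at hd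
      simp only [Fin.zero_eta, sideForm_zero, if_true]
      have h1 : (m ^ 2 + q ^ 2) * (m * time z - halfTrace m q * spaceX z) =
          m * ((m ^ 2 + q ^ 2) * time z - halfTrace m q * (m * spaceX z + q * coordR z)) := by
        linear_combination -halfTrace m q * q * hz
      have h2 : 0 ≤ (m ^ 2 + q ^ 2) * (m * time z - halfTrace m q * spaceX z) := by
        rw [h1]; apply mul_nonneg hm.le; linarith
      have h3 := nonneg_of_mul_nonneg_right h2 (by positivity)
      linarith
    · rw [Fin.mk_one, rep_of_one, mem_axis_symm_iff] at hz
      rw [dist_I_le_iff, Fin.mk_one, map_inv, rep_of_one, ← map_inv, symm_inv, moebius_apply,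
        time_symm_smul, hneg] at hd
      simp only [Fin.mk_one, sideForm_one, if_true]
      have h1 : (q ^ 2 + k ^ 2) * (k * time z - halfTrace q k * coordR z) =
          k * ((q ^ 2 + k ^ 2) * time z - halfTrace q k * (q * spaceX z + k * coordR z)) := by
        linear_combination halfTrace q k * q * hz
      have h2 : 0 ≤ (q ^ 2 + k ^ 2) * (k * time z - halfTrace q k * coordR z) := by
        rw [h1]; apply mul_nonneg hk.le; linarith
      have h3 := nonneg_of_mul_nonneg_right h2 (by positivity)
      linarith
  cross := by
    ext z
    rw [rep_of_zero, rep_of_one, Set.mem_inter_iff, mem_axis_symm_iff, mem_axis_symm_iff,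
      Set.mem_singleton_iff]
    constructor
    · rintro ⟨h1, h2⟩
      have hdet : m * k - q ^ 2 ≠ 0 := by linarith
      apply eq_I_of_space_eq_zero
      · apply (mul_eq_zero.1 (?_ : (m * k - q ^ 2) * spaceX z = 0)).resolve_left hdet
        linear_combination -q * h1 + m * h2
      · apply (mul_eq_zero.1 (?_ : (m * k - q ^ 2) * coordR z = 0)).resolve_left hdet
        linear_combination -k * h1 + q * h2
    · rintro rfl
      simp [spaceX, coordN, coordJ, coordR]

theorem rep_commutator (m q k : ℝ) : rep m q k (a * b * a⁻¹ * b⁻¹) =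
    moebius (symm m q * symm q k * (symm m q)⁻¹ * (symm q k)⁻¹) := by
  simp [rep, a, b]

/-- The marked one-holed torus in normal form with parameters `m`, `q`, `k`. -/
noncomputable def normalForm {L : ℝ} (hL : 0 ≤ L) (hm : 0 < m) (hk : 0 < k)
    (hC : m * k - q ^ 2 = Real.cosh (L / 4)) : MarkedStructure L :=
  have h1 : 1 + q ^ 2 ≤ m * k := by linarith [Real.one_le_cosh (L / 4)]
  have hP := pingPong_rep hm hk h1
  { hol := rep m q k
    orientation_preserving := fun g => ⟨FreeGroup.lift ![symm m q, symm q k] g, fun _ => rfl⟩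
    free := hP.free
    properly_discontinuous := hP.properly_discontinuous
    simple_a := hP.simple 0
    simple_b := hP.simple 1
    meet_once := ⟨UpperHalfPlane.I, by
      have := hP.cross
      change _ ∈ axis (rep m q k (FreeGroup.of 0)) ∩ axis (rep m q k (FreeGroup.of 1))
      rw [this]; rfl, fun g w hw => hP.meet_once g w hw⟩
    neck := by
      have hc := Real.one_le_cosh (L / 4)
      have htr : tr (symm m q * symm q k * (symm m q)⁻¹ * (symm q k)⁻¹) =
          -(2 * Real.cosh (L / 2)) := by
        have h2 := Real.cosh_two_mul (L / 4)
        rw [Real.sinh_sq, show 2 * (L / 4) = L / 2 by ring] at h2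
        rw [tr_commutator_symm, h2, ← hC]; ring
      have hc2 := Real.one_le_cosh (L / 2)
      have habs : |tr (symm m q * symm q k * (symm m q)⁻¹ * (symm q k)⁻¹)| =
          2 * Real.cosh (L / 2) := by
        rw [htr, abs_neg, abs_of_pos (by positivity)]
      have h3 := cosh_half_translationLength _ (by rw [habs]; linarith)
      rw [habs, mul_div_cancel_left₀ _ two_ne_zero] at h3
      have h4 := Real.cosh_injOn (div_nonneg (translationLength_nonneg _) two_pos.le)
        (div_nonneg hL two_pos.le) h3
      rw [rep_commutator]
      linarith }

end

/-! ### Every marked one-holed torus has a normal form -/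

theorem exists_symm_of_I_mem_axis (M : SL(2, ℝ)) (hfree : ∀ z, moebius M z ≠ z)
    (hI : UpperHalfPlane.I ∈ axis (moebius M)) : ∃ p q, moebius M = moebius (symm p q) := by
  have hM : 2 ≤ |tr M| := by
    by_contra! h
    obtain ⟨z, hz⟩ := exists_fixed_point M h
    exact hfree z hz
  rw [mem_axis_iff M hM] at hI
  have h01 : M 0 1 = M 1 0 := by
    simp [axisForm, coordN, coordR, coordJ] at hI
    linarith
  have hd := det_eq M
  obtain ⟨p, hp⟩ : ∃ p, p = (M 0 0 - M 1 1) / 2 := ⟨_, rfl⟩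
  have hsq : ((M 0 0 + M 1 1) / 2) ^ 2 = 1 + p ^ 2 + M 0 1 ^ 2 := by
    rw [hp]; linear_combination hd - M 0 1 * h01
  rcases le_total 0 (tr M) with h0 | h0
  · refine ⟨p, M 0 1, congrArg moebius ?_⟩
    have ht : halfTrace p (M 0 1) = (M 0 0 + M 1 1) / 2 := by
      rw [halfTrace, ← hsq]; exact Real.sqrt_sq (div_nonneg h0 two_pos.le)
    apply sl_ext
    · rw [symm_00, ht, hp]; ring
    · rw [symm_01]
    · rw [symm_10, h01]
    · rw [symm_11, ht, hp]; ring
  · refine ⟨-p, -M 0 1, ?_⟩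
    rw [← moebius_neg]
    congr 1
    have ht : halfTrace (-p) (-M 0 1) = -((M 0 0 + M 1 1) / 2) := by
      have h1 : 1 + (-p) ^ 2 + (-M 0 1) ^ 2 = (-((M 0 0 + M 1 1) / 2)) ^ 2 := by
        rw [neg_sq, neg_sq, neg_sq, hsq]
      have h2 : M 0 0 + M 1 1 ≤ 0 := h0
      rw [halfTrace, h1, Real.sqrt_sq (by linarith)]
    apply sl_ext
    · rw [symm_00, ht, hp]; simp; ring
    · rw [symm_01]; simp
    · rw [symm_10]; simp [h01]
    · rw [symm_11, ht, hp]; simp; ring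

theorem apply_mem_axis_conj (f φ : ℍ ≃ᵢ ℍ) {z : ℍ} (hz : z ∈ axis φ) :
    f z ∈ axis (f * φ * f⁻¹) := by
  change dist (f z) (f (φ (f.symm (f z)))) = translationLength (f * φ * f⁻¹)
  rw [translationLength_conj, f.symm_apply_apply, f.dist_eq]
  exact hz

/-- The reflection of the hyperbolic plane in the imaginary axis. -/
noncomputable def reflection : ℍ ≃ᵢ ℍ :=
  IsometryEquiv.mk' (fun z => ⟨⟨-z.re, z.im⟩, z.im_pos⟩) (fun z => ⟨⟨-z.re, z.im⟩, z.im_pos⟩)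
    (fun z => UpperHalfPlane.ext (Complex.ext (neg_neg z.re) rfl))
    (Isometry.of_dist_eq fun z w => by
      apply Real.cosh_injOn dist_nonneg dist_nonneg
      rw [UpperHalfPlane.cosh_dist', UpperHalfPlane.cosh_dist']
      change ((-z.re - -w.re) ^ 2 + z.im ^ 2 + w.im ^ 2) / (2 * z.im * w.im) = _
      ring)

theorem coordR_reflection (z : ℍ) : coordR (reflection z) = -coordR z := neg_div _ _

theorem coordJ_reflection (z : ℍ) : coordJ (reflection z) = coordJ z := rfl

theorem coordN_reflection (z : ℍ) : coordN (reflection z) = coordN z := by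
  change ((-z.re) ^ 2 + z.im ^ 2) / z.im = (z.re ^ 2 + z.im ^ 2) / z.im
  rw [neg_sq]

theorem reflection_conj_symm (p q : ℝ) :
    reflection * moebius (symm p q) * reflection⁻¹ = moebius (symm p (-q)) := by
  rw [mul_inv_eq_iff_eq_mul]
  have h : halfTrace p (-q) = halfTrace p q := by simp [halfTrace]
  ext1 z
  simp only [IsometryEquiv.mul_apply, moebius_apply]
  apply ext_coord
  · rw [coordR_reflection, coordR_smul, coordR_smul, coordR_reflection, coordJ_reflection,
      coordN_reflection]
    simp only [symm_00, symm_01, symm_10, symm_11, h]; ring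
  · rw [coordJ_reflection, coordJ_smul, coordJ_smul, coordR_reflection, coordJ_reflection,
      coordN_reflection]
    simp only [symm_10, symm_11, h]; ring

/-- The rotation about `i` by the angle `θ` (in the two space coordinates of the hyperboloid). -/
noncomputable def rotation (θ : ℝ) : SL(2, ℝ) :=
  ⟨!![Real.cos (θ / 2), -Real.sin (θ / 2); Real.sin (θ / 2), Real.cos (θ / 2)], by
    rw [Matrix.det_fin_two_of]; linear_combination Real.cos_sq_add_sin_sq (θ / 2)⟩

theorem rotation_conj_symm (θ p q : ℝ) : rotation θ * symm p q * (rotation θ)⁻¹ =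
    symm (p * Real.cos θ - q * Real.sin θ) (q * Real.cos θ + p * Real.sin θ) := by
  have h00 : rotation θ 0 0 = Real.cos (θ / 2) := rfl
  have h01 : rotation θ 0 1 = -Real.sin (θ / 2) := rfl
  have h10 : rotation θ 1 0 = Real.sin (θ / 2) := rfl
  have h11 : rotation θ 1 1 = Real.cos (θ / 2) := rfl
  have hc : Real.cos θ = Real.cos (θ / 2) ^ 2 - Real.sin (θ / 2) ^ 2 := by
    rw [← Real.cos_two_mul', mul_div_cancel₀ _ two_ne_zero]
  have hs : Real.sin θ = 2 * Real.sin (θ / 2) * Real.cos (θ / 2) := by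
    rw [← Real.sin_two_mul, mul_div_cancel₀ _ two_ne_zero]
  have ht : halfTrace (p * Real.cos θ - q * Real.sin θ) (q * Real.cos θ + p * Real.sin θ) =
      halfTrace p q := by
    unfold halfTrace
    congr 1
    linear_combination (p ^ 2 + q ^ 2) * Real.cos_sq_add_sin_sq θ
  have h1 := Real.cos_sq_add_sin_sq (θ / 2)
  apply sl_ext <;>
  simp only [mul_00, mul_01, mul_10, mul_11, inv_00, inv_01, inv_10, inv_11, symm_00, symm_01,
    symm_10, symm_11, h00, h01, h10, h11, ht] <;> rw [hs, hc]
  · linear_combination halfTrace p q * h1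
  · ring
  · ring
  · linear_combination halfTrace p q * h1

/-- A pair of vectors of positive determinant becomes a positive definite symmetric matrix after a
rotation (the polar decomposition in dimension two). -/
theorem exists_rotation {p q r s : ℝ} (hD : 0 < p * s - q * r) :
    ∃ θ m t k, 0 < m ∧ 0 < k ∧ m * k - t ^ 2 = p * s - q * r ∧
      rotation θ * symm p q * (rotation θ)⁻¹ = symm m t ∧
      rotation θ * symm r s * (rotation θ)⁻¹ = symm t k := by
  obtain ⟨w, hw⟩ : ∃ w : ℂ, w = ⟨p + s, r - q⟩ := ⟨_, rfl⟩
  have hn : ‖w‖ ^ 2 = (p + s) ^ 2 + (r - q) ^ 2 := by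
    rw [Complex.sq_norm, Complex.normSq_apply, hw]; ring
  have hw0 : 0 < ‖w‖ := by
    rcases (norm_nonneg w).eq_or_lt with h | h
    · rw [← h] at hn
      nlinarith [sq_nonneg (p - s), sq_nonneg (r + q)]
    · exact h
  have hc : ‖w‖ * Real.cos w.arg = p + s := by rw [Complex.norm_mul_cos_arg, hw]
  have hs : ‖w‖ * Real.sin w.arg = r - q := by rw [Complex.norm_mul_sin_arg, hw]
  have hcs := Real.cos_sq_add_sin_sq w.arg
  generalize w.arg = θ at hc hs hcs
  have heq : r * Real.cos θ - s * Real.sin θ = q * Real.cos θ + p * Real.sin θ := by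
    apply mul_left_cancel₀ hw0.ne'
    linear_combination (r - q) * hc - (p + s) * hs
  have hsum : (p * Real.cos θ - q * Real.sin θ) + (s * Real.cos θ + r * Real.sin θ) = ‖w‖ := by
    apply mul_left_cancel₀ hw0.ne'
    rw [← sq, hn]
    linear_combination (p + s) * hc + (r - q) * hs
  have hdet : (p * Real.cos θ - q * Real.sin θ) * (s * Real.cos θ + r * Real.sin θ) -
      (q * Real.cos θ + p * Real.sin θ) ^ 2 = p * s - q * r := by
    linear_combination (p * s - q * r) * hcs + (q * Real.cos θ + p * Real.sin θ) * heq
  have hprod : 0 < (p * Real.cos θ - q * Real.sin θ) * (s * Real.cos θ + r * Real.sin θ) := by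
    nlinarith [sq_nonneg (q * Real.cos θ + p * Real.sin θ)]
  refine ⟨θ, _, _, _, ?_, ?_, hdet, rotation_conj_symm _ _ _, ?_⟩
  · by_contra! h
    nlinarith
  · by_contra! h
    nlinarith
  · rw [rotation_conj_symm, heq]

theorem exists_conj_symm {p q r s C : ℝ} (hC : 0 < C) (hD : |p * s - q * r| = C) :
    ∃ m t k, 0 < m ∧ 0 < k ∧ m * k - t ^ 2 = C ∧ ∃ f : ℍ ≃ᵢ ℍ,
      f * moebius (symm p q) * f⁻¹ = moebius (symm m t) ∧
      f * moebius (symm r s) * f⁻¹ = moebius (symm t k) := by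
  rcases abs_eq hC.le |>.1 hD with h | h
  · obtain ⟨θ, m, t, k, hm, hk, hdet, h1, h2⟩ := exists_rotation (h ▸ hC)
    refine ⟨m, t, k, hm, hk, hdet.trans h, moebius (rotation θ), ?_, ?_⟩
    · rw [← h1]; simp
    · rw [← h2]; simp
  · have h' : p * -s - -q * r = C := by linarith
    obtain ⟨θ, m, t, k, hm, hk, hdet, h1, h2⟩ := exists_rotation (h' ▸ hC)
    refine ⟨m, t, k, hm, hk, hdet.trans h', moebius (rotation θ) * reflection, ?_, ?_⟩
    · rw [← h1, map_mul, map_mul, ← reflection_conj_symm]; simp [mul_assoc]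
    · rw [← h2, map_mul, map_mul, ← reflection_conj_symm]; simp [mul_assoc]

theorem commutator_ne_one : a * b * a⁻¹ * b⁻¹ ≠ 1 := by
  unfold a b; decide

theorem symm_mul_comm {p q r s : ℝ} (h : p * s = q * r) :
    symm p q * symm r s = symm r s * symm p q := by
  apply sl_ext <;> simp only [mul_00, mul_01, mul_10, mul_11, symm_00, symm_01, symm_10, symm_11]
  · ring
  · linear_combination 2 * h
  · linear_combination -2 * h
  · ring

/-- Every marked structure is conjugate to a representation in normal form. Moving the intersection
of the axes of `a` and `b` to `i` makes both holonomies symmetric matrices. As the action is free,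
the commutator is neither elliptic nor trivial, and its trace `2 - 4 D²`, where `D` is the
determinant of the two directions, gives `|D| = cosh (L / 4)`. A reflection makes `D` positive, and
a rotation about `i` makes the pair of directions a symmetric matrix. -/
theorem exists_conj_rep {L : ℝ} (S : MarkedStructure L) :
    ∃ m q k, 0 < m ∧ 0 < k ∧ m * k - q ^ 2 = Real.cosh (L / 4) ∧
      ∃ f : ℍ ≃ᵢ ℍ, ∀ g, rep m q k g = f * S.hol g * f⁻¹ := by
  obtain ⟨z₀, ⟨hza, hzb⟩, -⟩ := S.meet_once
  obtain ⟨T, hT⟩ := MulAction.exists_smul_eq SL(2, ℝ) z₀ UpperHalfPlane.I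
  have key : ∀ g : Pi1, g ≠ 1 → z₀ ∈ axis (S.hol g) →
      ∃ p q, moebius T * S.hol g * (moebius T)⁻¹ = moebius (symm p q) := by
    intro g hg hz
    obtain ⟨M, hM⟩ := S.orientation_preserving g
    have hM' : S.hol g = moebius M := by ext1 z; exact hM z
    rw [hM', ← map_inv, ← map_mul, ← map_mul]
    apply exists_symm_of_I_mem_axis
    · intro z hz'
      apply hg
      apply S.free g ((moebius T)⁻¹ z)
      rw [map_mul, map_mul, map_inv, IsometryEquiv.mul_apply, IsometryEquiv.mul_apply, ← hM'] at hz'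
      apply (moebius T).injective
      rw [hz', IsometryEquiv.apply_inv_self]
    · rw [map_mul, map_mul, map_inv, ← hM', ← hT]
      exact apply_mem_axis_conj _ _ hz
  obtain ⟨p, q, hpq⟩ := key a (by unfold a; decide) hza
  obtain ⟨r, s, hrs⟩ := key b (by unfold b; decide) hzb
  have hcomm : moebius T * S.hol (a * b * a⁻¹ * b⁻¹) * (moebius T)⁻¹ =
      moebius (symm p q * symm r s * (symm p q)⁻¹ * (symm r s)⁻¹) := by
    simp only [map_mul, map_inv, ← hpq, ← hrs]
    group
  have htr := tr_commutator_symm p q r s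
  -- If the directions were parallel, the two translations would commute.
  have hD0 : p * s - q * r ≠ 0 := by
    intro h0
    rw [symm_mul_comm (sub_eq_zero.1 h0), mul_inv_cancel_right, mul_inv_cancel, map_one,
      mul_inv_eq_one, mul_eq_left] at hcomm
    exact commutator_ne_one (S.free _ z₀ (by rw [hcomm]; rfl))
  generalize symm p q * symm r s * (symm p q)⁻¹ * (symm r s)⁻¹ = K at hcomm htr
  have hfree : ∀ z, moebius K z ≠ z := by
    intro z hz
    apply commutator_ne_one
    apply S.free _ ((moebius T)⁻¹ z)
    rw [← hcomm, IsometryEquiv.mul_apply, IsometryEquiv.mul_apply] at hz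
    apply (moebius T).injective
    rw [hz, IsometryEquiv.apply_inv_self]
  have hK : 2 ≤ |tr K| := by
    by_contra! h
    obtain ⟨z, hz⟩ := exists_fixed_point K h
    exact hfree z hz
  have hneck : translationLength (moebius K) = L := by
    rw [← hcomm, translationLength_conj]; exact S.neck
  have hcosh := cosh_half_translationLength K hK
  rw [hneck] at hcosh
  have h2 := Real.cosh_two_mul (L / 4)
  rw [Real.sinh_sq, show 2 * (L / 4) = L / 2 by ring, hcosh, htr] at h2
  have hC := Real.cosh_pos (L / 4)
  have hD : |p * s - q * r| = Real.cosh (L / 4) := by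
    have h3 : 1 ≤ (p * s - q * r) ^ 2 := by
      rw [htr] at hK
      rcases le_abs.1 hK with h | h
      · have : 0 < (p * s - q * r) ^ 2 := by positivity
        linarith
      · linarith
    rw [abs_of_nonpos (a := 2 - 4 * (p * s - q * r) ^ 2) (by linarith)] at h2
    have h4 : |p * s - q * r| ^ 2 = Real.cosh (L / 4) ^ 2 := by rw [sq_abs]; linarith
    exact (sq_eq_sq₀ (abs_nonneg _) hC.le).1 h4
  obtain ⟨m, t, k, hm, hk, hdet, f, h1, h2⟩ := exists_conj_symm hC hD
  refine ⟨m, t, k, hm, hk, hdet, f * moebius T, fun g => ?_⟩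
  have : rep m t k = (MulAut.conj (f * moebius T)).toMonoidHom.comp S.hol := by
    apply FreeGroup.ext_hom
    intro i
    have hconj : ∀ x, f * moebius T * x * (f * moebius T)⁻¹ =
        f * (moebius T * x * (moebius T)⁻¹) * f⁻¹ := fun x => by group
    fin_cases i
    · change rep m t k (FreeGroup.of 0) = f * moebius T * S.hol a * (f * moebius T)⁻¹
      rw [rep_of_zero, hconj, hpq, h1]
    · change rep m t k (FreeGroup.of 1) = f * moebius T * S.hol b * (f * moebius T)⁻¹
      rw [rep_of_one, hconj, hrs, h2]
  rw [this]; rfl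

/-! ### Length functions in Fenchel–Nielsen parameters -/

theorem symm_pow {r s β : ℝ} (hβ : 0 < β) (h : halfTrace r s = Real.cosh β) (n : ℕ) :
    (symm r s ^ n) 0 0 = Real.cosh (n * β) + Real.sinh (n * β) / Real.sinh β * r ∧
    (symm r s ^ n) 0 1 = Real.sinh (n * β) / Real.sinh β * s ∧
    (symm r s ^ n) 1 0 = Real.sinh (n * β) / Real.sinh β * s ∧
    (symm r s ^ n) 1 1 = Real.cosh (n * β) - Real.sinh (n * β) / Real.sinh β * r := by
  have hS := (Real.sinh_pos_iff.2 hβ).ne'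
  have hrs : r ^ 2 + s ^ 2 = Real.sinh β ^ 2 := by
    have := halfTrace_sq r s
    rw [h, Real.cosh_sq] at this
    linarith
  induction n with
  | zero => simp
  | succ n ih =>
    obtain ⟨h00, h01, h10, h11⟩ := ih
    rw [pow_succ, mul_00, mul_01, mul_10, mul_11, h00, h01, h10, h11]
    simp only [symm_00, symm_01, symm_10, symm_11, h]
    have hexp : ((n + 1 : ℕ) : ℝ) * β = n * β + β := by push_cast; ring
    rw [hexp, Real.cosh_add, Real.sinh_add]
    refine ⟨?_, ?_, ?_, ?_⟩ <;> field_simp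
    · linear_combination Real.sinh (n * β) * hrs
    · ring
    · ring
    · linear_combination Real.sinh (n * β) * hrs

/-- The factor by which `cosh (L_a / 2)` exceeds the hyperbolic cosine of the twist parameter along
`b`, for a torus with `L_b = 2 β` and neck length `L`, where `C = cosh (L / 4)`. -/
noncomputable def twistScale (C β : ℝ) : ℝ := √(1 + (C / Real.sinh β) ^ 2)

theorem twistScale_sq (C β : ℝ) : twistScale C β ^ 2 = 1 + (C / Real.sinh β) ^ 2 :=
  Real.sq_sqrt (by positivity)

theorem twistScale_pos (C β : ℝ) : 0 < twistScale C β := Real.sqrt_pos.2 (by positivity)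

/-- `(β, τ)` are Fenchel–Nielsen parameters, for the curve `b`, of the torus in normal form with
parameters `m`, `q`, `k`: the length of `b` is `2 β`, and `τ` measures the twist along `b`, normalised
so that `cosh (L_a / 2)` is proportional to `cosh τ`. -/
structure IsFenchelNielsen (C m q k β τ : ℝ) : Prop where
  pos : 0 < β
  cosh_b : halfTrace q k = Real.cosh β
  cosh_a : halfTrace m q = twistScale C β * Real.cosh τ
  inner : q * (m + k) = Real.sinh β * twistScale C β * Real.sinh τ

theorem exists_fenchelNielsen {C m q k : ℝ} (hm : 0 < m) (hk : 0 < k)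
    (hC : m * k - q ^ 2 = C) : ∃ β τ, IsFenchelNielsen C m q k β τ := by
  have hb := halfTrace_sq q k
  have hb1 : 1 < halfTrace q k := by
    have : 0 < k ^ 2 := by positivity
    nlinarith [sq_nonneg q, halfTrace_pos q k]
  obtain ⟨β, hβ⟩ : ∃ β, β = Real.arcosh (halfTrace q k) := ⟨_, rfl⟩
  have hcosh : Real.cosh β = halfTrace q k := by rw [hβ, Real.cosh_arcosh hb1.le]
  have hpos : 0 < β := by
    have h1 : 0 ≤ β := hβ ▸ Real.arcosh_nonneg hb1.le
    rcases h1.eq_or_lt with h | h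
    · rw [← h, Real.cosh_zero] at hcosh; linarith
    · exact h
  have hS := Real.sinh_pos_iff.2 hpos
  have hg := twistScale_pos C β
  have hg2 : Real.sinh β ^ 2 * twistScale C β ^ 2 = Real.sinh β ^ 2 + C ^ 2 := by
    rw [twistScale_sq]; field_simp
  have hS2 : Real.sinh β ^ 2 = q ^ 2 + k ^ 2 := by
    rw [Real.sinh_sq, hcosh, hb]; ring
  obtain ⟨τ, hτ⟩ : ∃ τ, τ = Real.arsinh (q * (m + k) / (Real.sinh β * twistScale C β)) := ⟨_, rfl⟩
  have hinner : q * (m + k) = Real.sinh β * twistScale C β * Real.sinh τ := by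
    rw [hτ, Real.sinh_arsinh]; field_simp
  refine ⟨β, τ, hpos, hcosh.symm, ?_, hinner⟩
  have hct := Real.cosh_pos τ
  have hsq : (Real.sinh β * halfTrace m q) ^ 2 =
      (Real.sinh β * (twistScale C β * Real.cosh τ)) ^ 2 := by
    have h1 : (Real.sinh β * (twistScale C β * Real.cosh τ)) ^ 2 =
        Real.sinh β ^ 2 * twistScale C β ^ 2 + (q * (m + k)) ^ 2 := by
      rw [hinner, mul_pow, mul_pow, Real.cosh_sq]; ring
    rw [h1, hg2, mul_pow, halfTrace_sq, hS2, ← hC]; ring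
  have h2 := (sq_eq_sq₀ (by have := halfTrace_pos m q; positivity) (by positivity)).1 hsq
  exact mul_left_cancel₀ hS.ne' h2

/-- All Fenchel–Nielsen parameters occur. -/
theorem exists_of_fenchelNielsen {C β : ℝ} (hC : 0 < C) (hβ : 0 < β) (τ : ℝ) :
    ∃ m q k, 0 < m ∧ 0 < k ∧ m * k - q ^ 2 = C ∧ IsFenchelNielsen C m q k β τ := by
  have hS := Real.sinh_pos_iff.2 hβ
  have hg := twistScale_pos C β
  have hg2 : Real.sinh β ^ 2 * twistScale C β ^ 2 = Real.sinh β ^ 2 + C ^ 2 := by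
    rw [twistScale_sq]; field_simp
  have hcτ := Real.cosh_pos τ
  have hcτ2 := Real.cosh_sq τ
  -- The symmetric matrix `P` with entries `m`, `q`, `k` satisfies `P² + C = (m + k) P`, and `P²`
  -- has entries `u`, `d`, `v` determined by the two lengths and the twist.
  obtain ⟨u, hu⟩ : ∃ u, u = (twistScale C β * Real.cosh τ) ^ 2 - 1 := ⟨_, rfl⟩
  obtain ⟨v, hv⟩ : ∃ v, v = Real.sinh β ^ 2 := ⟨_, rfl⟩
  obtain ⟨d, hd⟩ : ∃ d, d = Real.sinh β * twistScale C β * Real.sinh τ := ⟨_, rfl⟩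
  have hv0 : 0 < v := by rw [hv]; positivity
  have huv : u * v = d ^ 2 + C ^ 2 := by
    rw [hu, hv, hd]
    linear_combination hg2 + Real.sinh β ^ 2 * twistScale C β ^ 2 * hcτ2
  have hu0 : 0 < u := pos_of_mul_pos_left (by rw [huv]; positivity) hv0.le
  obtain ⟨σ, hσ0, hσ⟩ : ∃ σ, 0 < σ ∧ σ ^ 2 = u + v + 2 * C :=
    ⟨√(u + v + 2 * C), Real.sqrt_pos.2 (by positivity), Real.sq_sqrt (by positivity)⟩
  have hsum : (u + C) / σ + (v + C) / σ = σ := by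
    field_simp; linear_combination -hσ
  have hm2 : ((u + C) / σ) ^ 2 + (d / σ) ^ 2 = u := by
    field_simp; linear_combination -huv - u * hσ
  have hk2 : (d / σ) ^ 2 + ((v + C) / σ) ^ 2 = v := by
    field_simp; linear_combination -huv - v * hσ
  refine ⟨(u + C) / σ, d / σ, (v + C) / σ, by positivity, by positivity, ?_, hβ, ?_, ?_, ?_⟩
  · field_simp; linear_combination huv - C * hσ
  · have h1 : 1 + (d / σ) ^ 2 + ((v + C) / σ) ^ 2 = Real.cosh β ^ 2 := by
      rw [Real.cosh_sq, ← hv]; linarith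
    rw [halfTrace, h1, Real.sqrt_sq (Real.cosh_pos β).le]
  · have h1 : 1 + ((u + C) / σ) ^ 2 + (d / σ) ^ 2 = (twistScale C β * Real.cosh τ) ^ 2 := by
      linarith
    rw [halfTrace, h1, Real.sqrt_sq (by positivity)]
  · rw [hsum, div_mul_cancel₀ _ hσ0.ne', hd]

/-- The Fenchel–Nielsen parameters determine the torus. -/
theorem eq_of_fenchelNielsen {C m q k m' q' k' β τ : ℝ} (hm : 0 < m) (hk : 0 < k)
    (hC : m * k - q ^ 2 = C) (hm' : 0 < m') (hk' : 0 < k') (hC' : m' * k' - q' ^ 2 = C)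
    (h : IsFenchelNielsen C m q k β τ) (h' : IsFenchelNielsen C m' q' k' β τ) :
    m = m' ∧ q = q' ∧ k = k' := by
  have ha := halfTrace_sq m q
  have hb := halfTrace_sq q k
  have ha' := halfTrace_sq m' q'
  have hb' := halfTrace_sq q' k'
  have hi := h.inner.trans h'.inner.symm
  rw [h.cosh_a, ← h'.cosh_a, ha'] at ha
  rw [h.cosh_b, ← h'.cosh_b, hb'] at hb
  have hsum : m + k = m' + k' := by
    apply (sq_eq_sq₀ (by positivity) (by positivity)).1
    linear_combination -ha - hb + 2 * hC - 2 * hC'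
  have hpos : 0 < m' + k' := by positivity
  have hq : q = q' := by
    rw [hsum] at hi
    exact mul_right_cancel₀ hpos.ne' hi
  have hdiff : m - k = m' - k' := by
    apply mul_left_cancel₀ hpos.ne'
    linear_combination -(m - k) * hsum - ha + hb
  exact ⟨by linarith, hq, by linarith⟩

/-- The trace of `a² bⁿ` in Fenchel–Nielsen parameters, written as `2 + 4 sinh²` of a quarter of the
length. -/
theorem tr_word {C m q k β τ : ℝ} (h : IsFenchelNielsen C m q k β τ) (n : ℕ) :
    tr (symm m q ^ 2 * symm q k ^ n) = 2 + 4 * ((twistScale C β * Real.sinh (τ + n / 2 * β)) ^ 2 +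
      (C * (Real.cosh (n / 2 * β) / Real.sinh β)) ^ 2) := by
  have hS := (Real.sinh_pos_iff.2 h.pos).ne'
  obtain ⟨h00, h01, h10, h11⟩ := symm_pow h.pos h.cosh_b n
  have hin := h.inner
  have hg := twistScale_sq C β
  have ha := halfTrace_sq m q
  have h1 : tr (symm m q ^ 2 * symm q k ^ n) = 2 * (2 * halfTrace m q ^ 2 - 1) * Real.cosh (n * β) +
      4 * halfTrace m q * (q * (m + k)) * (Real.sinh (n * β) / Real.sinh β) := by
    rw [tr, mul_00, mul_11, h00, h01, h10, h11, sq, mul_00, mul_01, mul_10, mul_11]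
    simp only [symm_00, symm_01, symm_10, symm_11]
    linear_combination -2 * Real.cosh (n * β) * ha
  have h2 : (n : ℝ) * β = 2 * (n / 2 * β) := by ring
  rw [h1, hin, h.cosh_a, h2, Real.cosh_two_mul, Real.sinh_two_mul, Real.sinh_add]
  have h3 := Real.cosh_sq τ
  have h4 := Real.cosh_sq (n / 2 * β)
  generalize n / 2 * β = x at *
  have h5 : (C * (Real.cosh x / Real.sinh β)) ^ 2 = (twistScale C β ^ 2 - 1) * Real.cosh x ^ 2 := by
    rw [hg]; ring
  rw [h5]
  generalize twistScale C β = g at *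
  have h6 : 4 * (g * Real.cosh τ) * (Real.sinh β * g * Real.sinh τ) *
      (2 * Real.sinh x * Real.cosh x / Real.sinh β) =
      8 * g ^ 2 * Real.cosh τ * Real.sinh τ * Real.sinh x * Real.cosh x := by
    field_simp; ring
  rw [h6]
  linear_combination 4 * g ^ 2 * Real.cosh x ^ 2 * h3 + 2 * h4

theorem rep_word (m q k : ℝ) (n : ℕ) :
    rep m q k (a ^ 2 * b ^ n) = moebius (symm m q ^ 2 * symm q k ^ n) := by
  simp [rep, a, b]

/-- The length of `a² bⁿ`: a term that vanishes for exactly one value of the twist, and a term that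
depends on the length of `b` only. -/
theorem sinh_sq_length_word {C m q k β τ : ℝ} (h : IsFenchelNielsen C m q k β τ) (n : ℕ) :
    Real.sinh (translationLength (rep m q k (a ^ 2 * b ^ n)) / 4) ^ 2 =
      (twistScale C β * Real.sinh (τ + n / 2 * β)) ^ 2 +
      (C * (Real.cosh (n / 2 * β) / Real.sinh β)) ^ 2 := by
  have htr := tr_word h n
  generalize hE : (twistScale C β * Real.sinh (τ + n / 2 * β)) ^ 2 +
      (C * (Real.cosh (n / 2 * β) / Real.sinh β)) ^ 2 = E at *
  have hE0 : 0 ≤ E := by rw [← hE]; positivity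
  have habs : |tr (symm m q ^ 2 * symm q k ^ n)| = 2 + 4 * E := by
    rw [htr, abs_of_nonneg (by positivity)]
  have h1 := cosh_half_translationLength _ (by rw [habs]; linarith)
  rw [rep_word]
  generalize translationLength (moebius (symm m q ^ 2 * symm q k ^ n)) = ℓ at *
  have h2 := Real.cosh_two_mul (ℓ / 4)
  rw [show 2 * (ℓ / 4) = ℓ / 2 by ring, h1, habs, Real.cosh_sq] at h2
  linarith

theorem cosh_half_length_symm (p q : ℝ) :
    Real.cosh (translationLength (moebius (symm p q)) / 2) = halfTrace p q := by
  rw [cosh_half_translationLength _ (two_le_abs_tr_symm p q), tr_symm,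
    abs_of_pos (by have := halfTrace_pos p q; positivity)]
  ring

theorem length_pos_of_one_lt_cosh {f : ℍ ≃ᵢ ℍ}
    (h : 1 < Real.cosh (translationLength f / 2)) : 0 < translationLength f := by
  rcases (translationLength_nonneg f).eq_or_lt with h0 | h0
  · rw [← h0, zero_div, Real.cosh_zero] at h; exact absurd h (lt_irrefl _)
  · exact h0

theorem mem_teichLength {L m q k : ℝ} (hm : 0 < m) (hk : 0 < k)
    (hC : m * k - q ^ 2 = Real.cosh (L / 4)) :
    (translationLength (rep m q k a), translationLength (rep m q k b),
      translationLength (rep m q k (a * b))) ∈ TeichLength L := by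
  have hab : rep m q k (a * b) = moebius (symm m q * symm q k) := by simp [rep, a, b]
  have h1 := halfTrace_sq m q
  have h2 := halfTrace_sq q k
  have hp1 := halfTrace_pos m q
  have hp2 := halfTrace_pos q k
  have hmm : 0 < m ^ 2 := by positivity
  have hkk : 0 < k ^ 2 := by positivity
  have ha1 : 1 < halfTrace m q := by nlinarith [sq_nonneg q]
  have hb1 : 1 < halfTrace q k := by nlinarith [sq_nonneg q]
  have hz : 1 < halfTrace m q * halfTrace q k + q * (m + k) := by
    have h3 : (1 - q * (m + k)) ^ 2 < (halfTrace m q * halfTrace q k) ^ 2 := by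
      rw [mul_pow, h1, h2]
      have h4 : 0 < (m * k - q ^ 2) ^ 2 := by rw [hC]; positivity
      linarith [sq_nonneg (m + q), sq_nonneg (q + k)]
    have h4 := abs_lt_of_sq_lt_sq h3 (by positivity)
    linarith [le_abs_self (1 - q * (m + k))]
  have ea : Real.cosh (translationLength (rep m q k a) / 2) = halfTrace m q := by
    change Real.cosh (translationLength (rep m q k (FreeGroup.of 0)) / 2) = _
    rw [rep_of_zero, cosh_half_length_symm]
  have eb : Real.cosh (translationLength (rep m q k b) / 2) = halfTrace q k := by
    change Real.cosh (translationLength (rep m q k (FreeGroup.of 1)) / 2) = _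
    rw [rep_of_one, cosh_half_length_symm]
  have eab : Real.cosh (translationLength (rep m q k (a * b)) / 2) =
      halfTrace m q * halfTrace q k + q * (m + k) := by
    have htr : |tr (symm m q * symm q k)| =
        2 * (halfTrace m q * halfTrace q k + q * (m + k)) := by
      rw [tr_symm_mul, show m * q + q * k = q * (m + k) by ring, abs_of_pos (by linarith)]
    rw [hab, cosh_half_translationLength _ (by rw [htr]; linarith), htr]
    ring
  refine ⟨length_pos_of_one_lt_cosh (ea ▸ ha1), length_pos_of_one_lt_cosh (eb ▸ hb1),
    length_pos_of_one_lt_cosh (eab ▸ hz), ?_⟩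
  have h5 := Real.cosh_two_mul (L / 4)
  rw [Real.sinh_sq, show 2 * (L / 4) = L / 2 by ring] at h5
  simp only [ea, eb, eab]
  rw [h5, ← hC]
  linear_combination 4 * (1 - halfTrace q k ^ 2) * h1 - 4 * (m ^ 2 + q ^ 2) * h2

/-! ### The critical length of `b` -/

/-- The derivative of `cosh (ν t) / sinh t`, multiplied by `sinh² t`. -/
noncomputable def crit (ν t : ℝ) : ℝ :=
  ν * Real.sinh (ν * t) * Real.sinh t - Real.cosh (ν * t) * Real.cosh t

theorem crit_strictMonoOn {ν : ℝ} (hν : 1 < ν) : StrictMonoOn (crit ν) (Set.Ici 0) := by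
  have hder : ∀ t, HasDerivAt (crit ν) ((ν ^ 2 - 1) * (Real.cosh (ν * t) * Real.sinh t)) t := by
    intro t
    have h0 : HasDerivAt (fun t => ν * t) ν t := by simpa using (hasDerivAt_id t).const_mul ν
    have h1 := ((h0.sinh.const_mul ν).mul (Real.hasDerivAt_sinh t)).sub
      (h0.cosh.mul (Real.hasDerivAt_cosh t))
    refine HasDerivAt.congr_deriv (f := crit ν) h1 ?_
    ring
  apply strictMonoOn_of_deriv_pos (convex_Ici 0)
  · exact fun t _ => (hder t).continuousAt.continuousWithinAt
  · intro t ht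
    rw [interior_Ici] at ht
    rw [(hder t).deriv]
    have h1 := Real.sinh_pos_iff.2 ht
    have h2 := Real.cosh_pos (ν * t)
    have h3 : 0 < ν ^ 2 - 1 := by nlinarith
    positivity

theorem crit_eq_zero_iff {ν t : ℝ} :
    crit ν t = 0 ↔ ν * Real.tanh (ν * t) * Real.tanh t = 1 := by
  have h1 := (Real.cosh_pos (ν * t)).ne'
  have h2 := (Real.cosh_pos t).ne'
  rw [Real.tanh_eq_sinh_div_cosh, Real.tanh_eq_sinh_div_cosh, crit, sub_eq_zero]
  field_simp

theorem exists_crit_eq_zero {ν : ℝ} (hν : 3 / 2 ≤ ν) : ∃ β, 0 < β ∧ crit ν β = 0 := by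
  have hcont : Continuous (crit ν) := by
    unfold crit
    have := Real.continuous_sinh
    have := Real.continuous_cosh
    fun_prop
  have h0 : crit ν 0 < 0 := by simp [crit]
  obtain ⟨T, hT⟩ : ∃ T, Real.sinh T = 4 := ⟨_, Real.sinh_arsinh 4⟩
  have hT0 : 0 < T := Real.sinh_pos_iff.1 (by rw [hT]; norm_num)
  have hle : 4 ≤ Real.sinh (ν * T) := by
    rw [← hT, Real.sinh_le_sinh]; nlinarith
  have h1 : 0 < crit ν T := by
    have h2 := Real.cosh_sub (ν * T) T
    have h3 : Real.cosh (ν * T - T) ≤ Real.cosh (ν * T) := by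
      rw [Real.cosh_le_cosh, abs_of_nonneg (by nlinarith), abs_of_nonneg (by nlinarith)]
      linarith
    have h4 : Real.cosh (ν * T) < 2 * Real.sinh (ν * T) := by
      have := Real.cosh_sq (ν * T)
      nlinarith [Real.cosh_pos (ν * T)]
    have h5 : crit ν T = (ν - 1) * 4 * Real.sinh (ν * T) - Real.cosh (ν * T - T) := by
      rw [h2, crit, hT]; ring
    rw [h5]
    nlinarith
  obtain ⟨β, hβ, hz⟩ := intermediate_value_Ioo hT0.le hcont.continuousOn ⟨h0, h1⟩
  exact ⟨β, hβ.1, hz⟩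

/-- The function `cosh (ν t) / sinh t` of `t > 0` has its strict minimum at the zero of `crit ν`. -/
theorem cosh_div_sinh_lt {ν β t : ℝ} (hν : 1 < ν) (hβ : 0 < β) (hz : crit ν β = 0) (ht : 0 < t)
    (hne : t ≠ β) : Real.cosh (ν * β) / Real.sinh β < Real.cosh (ν * t) / Real.sinh t := by
  have hder : ∀ t, 0 < t → HasDerivAt (fun t => Real.cosh (ν * t) / Real.sinh t)
      (crit ν t / Real.sinh t ^ 2) t := by
    intro t ht
    have h0 : HasDerivAt (fun t => ν * t) ν t := by simpa using (hasDerivAt_id t).const_mul ν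
    have h1 := h0.cosh.div (Real.hasDerivAt_sinh t) (Real.sinh_pos_iff.2 ht).ne'
    refine h1.congr_deriv ?_
    unfold crit; ring
  have hmono := crit_strictMonoOn hν
  rcases lt_or_gt_of_ne hne with h | h
  · have hanti : StrictAntiOn (fun t => Real.cosh (ν * t) / Real.sinh t) (Set.Icc t β) := by
      apply strictAntiOn_of_deriv_neg (convex_Icc t β)
      · exact fun x hx => (hder x (ht.trans_le hx.1)).continuousAt.continuousWithinAt
      · intro x hx
        rw [interior_Icc] at hx
        have hx0 := ht.trans hx.1
        rw [(hder x hx0).deriv]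
        have h1 := hmono (Set.mem_Ici.2 hx0.le) (Set.mem_Ici.2 hβ.le) hx.2
        rw [hz] at h1
        exact div_neg_of_neg_of_pos h1 (pow_pos (Real.sinh_pos_iff.2 hx0) 2)
    exact hanti (Set.left_mem_Icc.2 h.le) (Set.right_mem_Icc.2 h.le) h
  · have hmon : StrictMonoOn (fun t => Real.cosh (ν * t) / Real.sinh t) (Set.Icc β t) := by
      apply strictMonoOn_of_deriv_pos (convex_Icc β t)
      · exact fun x hx => (hder x (hβ.trans_le hx.1)).continuousAt.continuousWithinAt
      · intro x hx
        rw [interior_Icc] at hx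
        have hx0 := hβ.trans hx.1
        rw [(hder x hx0).deriv]
        have h1 := hmono (Set.mem_Ici.2 hβ.le) (Set.mem_Ici.2 hx0.le) hx.1
        rw [hz] at h1
        exact div_pos h1 (pow_pos (Real.sinh_pos_iff.2 hx0) 2)
    exact hmon (Set.left_mem_Icc.2 h.le) (Set.right_mem_Icc.2 h.le) h

/-! ### The minimum -/

theorem exists_normalForm {L : ℝ} (hL : 0 ≤ L) (Y : Teich L) :
    ∃ (m q k : ℝ) (hm : 0 < m) (hk : 0 < k) (hC : m * k - q ^ 2 = Real.cosh (L / 4)),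
      Y = Quotient.mk _ (normalForm hL hm hk hC) := by
  induction Y using Quotient.inductionOn with
  | h S =>
    obtain ⟨m, q, k, hm, hk, hC, f, hf⟩ := exists_conj_rep S
    exact ⟨m, q, k, hm, hk, hC, Quotient.sound ⟨f, hf⟩⟩

theorem length_normalForm {L m q k : ℝ} (hL : 0 ≤ L) (hm : 0 < m) (hk : 0 < k)
    (hC : m * k - q ^ 2 = Real.cosh (L / 4)) (g : Pi1) :
    Teich.length (Quotient.mk _ (normalForm hL hm hk hC)) g = translationLength (rep m q k g) :=
  rfl

/-- A lower bound for the length of `a² bⁿ`, attained for exactly one pair of Fenchel–Nielsen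
parameters. -/
theorem sinh_sq_length_word_lower {C m q k β τ β₀ : ℝ} (hC : 0 < C) {n : ℕ} (hn : 3 ≤ n)
    (hβ₀ : 0 < β₀) (hz : crit (n / 2) β₀ = 0) (h : IsFenchelNielsen C m q k β τ) :
    (C * (Real.cosh (n / 2 * β₀) / Real.sinh β₀)) ^ 2 ≤
      Real.sinh (translationLength (rep m q k (a ^ 2 * b ^ n)) / 4) ^ 2 ∧
    (Real.sinh (translationLength (rep m q k (a ^ 2 * b ^ n)) / 4) ^ 2 ≤
      (C * (Real.cosh (n / 2 * β₀) / Real.sinh β₀)) ^ 2 → β = β₀ ∧ τ = -(n / 2 * β₀)) := by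
  have hn' : (3 : ℝ) ≤ n := by exact_mod_cast hn
  rw [sinh_sq_length_word h]
  have hS₀ := Real.sinh_pos_iff.2 hβ₀
  have hS := Real.sinh_pos_iff.2 h.pos
  have hc := Real.cosh_pos (n / 2 * β₀)
  have hsq := sq_nonneg (twistScale C β * Real.sinh (τ + n / 2 * β))
  by_cases hβ : β = β₀
  · subst hβ
    refine ⟨by linarith, fun hle => ⟨rfl, ?_⟩⟩
    have h0 : twistScale C β * Real.sinh (τ + n / 2 * β) = 0 := by nlinarith
    have h1 := (mul_eq_zero.1 h0).resolve_left (twistScale_pos C β).ne'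
    rw [Real.sinh_eq_zero] at h1
    linarith
  · have hlt := cosh_div_sinh_lt (by linarith : (1 : ℝ) < n / 2) hβ₀ hz h.pos hβ
    have h1 : (C * (Real.cosh (n / 2 * β₀) / Real.sinh β₀)) ^ 2 <
        (C * (Real.cosh (n / 2 * β) / Real.sinh β)) ^ 2 := by gcongr
    exact ⟨by linarith, fun hle => by linarith⟩

theorem translationLength_le_of_sinh_sq_le {f g : ℍ ≃ᵢ ℍ}
    (h : Real.sinh (translationLength f / 4) ^ 2 ≤ Real.sinh (translationLength g / 4) ^ 2) :
    translationLength f ≤ translationLength g := by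
  have h1 := translationLength_nonneg g
  have h2 := abs_le_of_sq_le_sq h (Real.sinh_nonneg_iff.2 (by linarith))
  have h3 := Real.sinh_le_sinh.1 ((le_abs_self _).trans h2)
  linarith

end OneHoledTorus

open OneHoledTorus in
theorem theorem4p1 (n : ℕ) (hn : 3 ≤ n) :
    ∃ Lb : ℝ,
      (0 < Lb ∧ (n : ℝ) / 2 * Real.tanh ((n : ℝ) * Lb / 4) * Real.tanh (Lb / 2) = 1) ∧
      (∀ t : ℝ, 0 < t → (n : ℝ) / 2 * Real.tanh ((n : ℝ) * t / 4) * Real.tanh (t / 2) = 1 →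
        t = Lb) ∧
      ∀ L : ℝ, 0 ≤ L →
        ∃ X : OneHoledTorus.Teich L,
          (∀ Y : OneHoledTorus.Teich L,
            X.length (OneHoledTorus.a ^ 2 * OneHoledTorus.b ^ n) ≤
              Y.length (OneHoledTorus.a ^ 2 * OneHoledTorus.b ^ n)) ∧
          (∀ X' : OneHoledTorus.Teich L,
            (∀ Y : OneHoledTorus.Teich L,
              X'.length (OneHoledTorus.a ^ 2 * OneHoledTorus.b ^ n) ≤
                Y.length (OneHoledTorus.a ^ 2 * OneHoledTorus.b ^ n)) → X' = X) ∧
          (X.length OneHoledTorus.a, X.length OneHoledTorus.b,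
            X.length (OneHoledTorus.a * OneHoledTorus.b)) ∈ OneHoledTorus.TeichLength L ∧
          X.length OneHoledTorus.b = Lb ∧
          Real.sinh (X.length (OneHoledTorus.a ^ 2 * OneHoledTorus.b ^ n) / 4) =
            (n : ℝ) / 2 * Real.cosh (L / 4) * Real.sinh ((n : ℝ) * Lb / 4)
              / Real.cosh (Lb / 2) := by
  have hn' : (3 : ℝ) ≤ n := by exact_mod_cast hn
  obtain ⟨β, hβ, hz⟩ := exists_crit_eq_zero (by linarith : (3 / 2 : ℝ) ≤ n / 2)
  have e1 : (n : ℝ) * (2 * β) / 4 = n / 2 * β := by ring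
  have e2 : 2 * β / 2 = β := by ring
  refine ⟨2 * β, ⟨by positivity, ?_⟩, ?_, ?_⟩
  · rw [e1, e2]; exact crit_eq_zero_iff.1 hz
  · intro t ht h
    rw [show (n : ℝ) * t / 4 = n / 2 * (t / 2) by ring] at h
    have h1 := crit_eq_zero_iff.2 h
    have h2 := (crit_strictMonoOn (by linarith : (1 : ℝ) < n / 2)).injOn
      (Set.mem_Ici.2 (half_pos ht).le) (Set.mem_Ici.2 hβ.le) (h1.trans hz.symm)
    linarith
  · intro L hL
    have hC := Real.cosh_pos (L / 4)
    obtain ⟨m, q, k, hm, hk, hdet, hFN⟩ := exists_of_fenchelNielsen hC hβ (-(n / 2 * β))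
    have hS := Real.sinh_pos_iff.2 hβ
    have hc := Real.cosh_pos (n / 2 * β)
    have hmin : Real.sinh (translationLength (rep m q k (a ^ 2 * b ^ n)) / 4) ^ 2 =
        (Real.cosh (L / 4) * (Real.cosh (n / 2 * β) / Real.sinh β)) ^ 2 := by
      rw [sinh_sq_length_word hFN, neg_add_cancel, Real.sinh_zero]; ring
    refine ⟨Quotient.mk _ (normalForm hL hm hk hdet), ?_, ?_, mem_teichLength hm hk hdet, ?_, ?_⟩
    · intro Y
      obtain ⟨m', q', k', hm', hk', hdet', rfl⟩ := exists_normalForm hL Y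
      obtain ⟨β', τ', hFN'⟩ := exists_fenchelNielsen hm' hk' hdet'
      rw [length_normalForm, length_normalForm]
      apply translationLength_le_of_sinh_sq_le
      rw [hmin]
      exact (sinh_sq_length_word_lower hC hn hβ hz hFN').1
    · intro X' hX'
      obtain ⟨m', q', k', hm', hk', hdet', rfl⟩ := exists_normalForm hL X'
      obtain ⟨β', τ', hFN'⟩ := exists_fenchelNielsen hm' hk' hdet'
      have hle := hX' (Quotient.mk _ (normalForm hL hm hk hdet))
      rw [length_normalForm, length_normalForm] at hle
      have hle' : Real.sinh (translationLength (rep m' q' k' (a ^ 2 * b ^ n)) / 4) ^ 2 ≤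
          (Real.cosh (L / 4) * (Real.cosh (n / 2 * β) / Real.sinh β)) ^ 2 := by
        rw [← hmin]
        have h0 := translationLength_nonneg (rep m' q' k' (a ^ 2 * b ^ n))
        have h1 : 0 ≤ Real.sinh (translationLength (rep m' q' k' (a ^ 2 * b ^ n)) / 4) :=
          Real.sinh_nonneg_iff.2 (by linarith)
        have h2 : Real.sinh (translationLength (rep m' q' k' (a ^ 2 * b ^ n)) / 4) ≤
            Real.sinh (translationLength (rep m q k (a ^ 2 * b ^ n)) / 4) :=
          Real.sinh_le_sinh.2 (by linarith)
        gcongr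
      obtain ⟨rfl, rfl⟩ := (sinh_sq_length_word_lower hC hn hβ hz hFN').2 hle'
      obtain ⟨rfl, rfl, rfl⟩ := eq_of_fenchelNielsen hm' hk' hdet' hm hk hdet hFN' hFN
      rfl
    · rw [length_normalForm]
      change translationLength (rep m q k (FreeGroup.of 1)) = _
      rw [rep_of_one]
      have h1 := cosh_half_length_symm q k
      rw [hFN.cosh_b] at h1
      have h2 := Real.cosh_injOn (div_nonneg (translationLength_nonneg _) two_pos.le) hβ.le h1
      linarith
    · rw [length_normalForm, e1, e2]
      have h0 := translationLength_nonneg (rep m q k (a ^ 2 * b ^ n))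
      rw [(sq_eq_sq₀ (Real.sinh_nonneg_iff.2 (by linarith)) (by positivity)).1 hmin]
      have hcβ := Real.cosh_pos β
      have hz' : n / 2 * Real.sinh (n / 2 * β) * Real.sinh β =
          Real.cosh (n / 2 * β) * Real.cosh β := sub_eq_zero.1 hz
      rw [← mul_div_assoc, div_eq_div_iff hS.ne' hcβ.ne']
      linear_combination -Real.cosh (L / 4) * hz'
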